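/- Let $G$ be a finite simple graph with $n$ vertices, and let $\varphi$ assign to each oriented edge $\vec{uv}$ of $G$ a complex number of modulus $1$ with $\varphi(\vec{vu})=\varphi(\vec{uv})^{-1}$; the pair $(G,\varphi)$ is called a complex unit gain graph. Let $r(G,\varphi)$ be the rank of its Hermitian adjacency matrix, whose $(u,v)$ entry is $\varphi(\vec{uv})$ if $u$ and $v$ are adjacent and $0$ otherwise. Let $\alpha(\cdot)$ denote the independence number, and let $c(G)=|E(G)|-|V(G)|+\omega(G)$ be the cyclomatic number, where $\omega(G)$ is the number of connected components of $G$. For a cycle $C_l=v_1v_2\cdots v_lv_1$ of $G$ with $l$ vertices put $\varphi(C_l)=\varphi(\vec{v_1v_2})\varphi(\vec{v_2v_3})\cdots\varphi(\vec{v_lv_1})$. Then $$r(G,\varphi)=2n-2c(G)-2\alpha(G)$$ if and only if all of the following three conditions hold: (i) the cycles of $G$ (if any) are pairwise vertex-disjoint; (ii) for every cycle $C_l$ of $G$ (if any), either $l$ is even and $\varphi(C_l)=(-1)^{l/2}$, or $l$ is odd and $\operatorname{Re}\bigl((-1)^{(l-1)/2}\varphi(C_l)\bigr)=0$; (iii)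 $\alpha(T_G)=\alpha([T_G])+c(G)$, where $T_G$ is the acyclic graph obtained from $G$ by contracting each cycle to a vertex (defined when (i) holds), and $[T_G]$ is the subgraph of $T_G$ induced by the vertices that do not arise by contracting a cycle. The condition (ii) does not depend on the starting vertex or the direction in which a cycle is traversed. -/

import Mathlib

/-- A complex unit gain graph on the vertex set `V`: a simple graph together with a gain function
from its oriented edges (darts) to the unit circle, which takes inverse values on the two
orientations of an edge. -/
structure ComplexUnitGainGraph (V : Type*) where
  /-- The underlying simple graph. -/
  graph : SimpleGraph V
  /-- The gain function on oriented edges. -/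
  gain : graph.Dart → Circle
  gain_symm : ∀ d : graph.Dart, gain d.symm = (gain d)⁻¹

namespace ComplexUnitGainGraph

variable {V : Type*} (Φ : ComplexUnitGainGraph V)

open Classical in
/-- The (Hermitian) adjacency matrix: the `(u, v)` entry is the gain of the oriented edge from
`u` to `v` if `u` and `v` are adjacent, and `0` otherwise. -/
noncomputable def adjMatrix : Matrix V V ℂ :=
  Matrix.of fun u v => if h : Φ.graph.Adj u v then (Φ.gain ⟨(u, v), h⟩ : ℂ) else 0

/-- The rank of a complex unit gain graph is the rank of its adjacency matrix. -/
noncomputable def rank [Fintype V] : ℕ := Φ.adjMatrix.rank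

/-- The gain of a walk: the product of the gains of its successive oriented edges. -/
noncomputable def walkGain {u v : V} (p : Φ.graph.Walk u v) : Circle := (p.darts.map Φ.gain).prod

end ComplexUnitGainGraph

namespace SimpleGraph

variable {V : Type*} (G : SimpleGraph V)

/-- The cyclomatic number `|E(G)| - |V(G)| + ω(G)` of a finite graph, where `ω(G)` is the number of
connected components. -/
noncomputable def cyclomaticNumber : ℤ :=
  (Nat.card G.edgeSet : ℤ) - Nat.card V + Nat.card G.ConnectedComponent

/-- The set of all cycles of `G`, as subgraphs of `G`. -/
def cycleSubgraphs : Set G.Subgraph :=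
  {C | ∃ (v : V) (p : G.Walk v v), p.IsCycle ∧ C = p.toSubgraph}

/-- The equivalence relation on vertices generated by lying on a common cycle. When the cycles of
`G` are pairwise vertex-disjoint, its classes are the vertex sets of the cycles and the singletons
of the vertices that lie on no cycle. -/
def cycleSetoid : Setoid V :=
  Relation.EqvGen.setoid fun u v => ∃ C ∈ G.cycleSubgraphs, u ∈ C.verts ∧ v ∈ C.verts

/-- The simple graph `T_G` obtained from `G` by contracting each cycle to a vertex. -/
def cycleContraction : SimpleGraph (Quotient G.cycleSetoid) :=
  G.map (Quotient.mk G.cycleSetoid)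

/-- The cyclic vertices of `T_G`: those onto which some cycle of `G` has been contracted. -/
def cyclicVertices : Set (Quotient G.cycleSetoid) :=
  {x | ∃ C ∈ G.cycleSubgraphs, ∃ v ∈ C.verts, x = Quotient.mk G.cycleSetoid v}

/-- The graph `[T_G]`: the subgraph of `T_G` induced by the non-cyclic vertices. -/
def reducedCycleContraction : SimpleGraph ↥(G.cyclicVerticesᶜ) :=
  G.cycleContraction.induce G.cyclicVerticesᶜ

end SimpleGraph

/-! Fix one Hermitian matrix `W` with all entries of modulus 1 and let the defect of a graph `H` on
`V` be r + 2c + 2α − 2n, where r is the rank of `W` masked to the edges of `H`. Vertices are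
isolated rather than deleted, so n stays fixed and inductions run over the subgraph order. Forests
have defect 0, by removing leaves. Isolating a cyclic vertex does not increase r, lowers c by at
least 1 and raises α by at most 1; hence it does not increase the defect, and the defect is never
negative. The theorem characterizes defect 0.

Necessity. If the defect is 0, isolating a cyclic vertex v forces equality in all three estimates.
Constancy of r yields a null vector nonzero at v (`exists_null_of_isCyclic`); a drop of c by exactly
1 makes the cycles disjoint. Next take a bridge uy with u cyclic. A null vector on the y-side
nonzero at y would put e_u in the range of A, the masked matrix of `H`, against the null vector at
u, since kernel and range are orthogonal. So y is not cyclic. Comparing the two sides gives more: A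
z = e_y with z_y = 0 (`exists_range`), so isolating y lowers r by 2, raises α by 1 and keeps defect
0. An exchange of independent sets then shows that the bridge can be deleted without changing the
defect or α. Deleting all such bridges leaves each cycle as a component with a null vector, and
solving the equations around the cycle gives the gain condition. The behaviour of α gives a maximum
independent set of non-cyclic vertices with no cyclic neighbour, which together with the absence of
edges between distinct cycles is condition (iii) (`indepNum_contraction_iff`).

Sufficiency. Given such a set S, isolating the non-cyclic vertices outside S leaves exactly the
cycles as components. These have defect 0 by the gain condition, and counting r, c and α shows that
the original defect is at most 0. -/

set_option linter.unusedSectionVars false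

open Matrix

open scoped ComplexConjugate

/-! ### Rank after zeroing a row and a column -/

namespace Matrix

variable {V : Type*} [Fintype V] [DecidableEq V]

/-- The diagonal projection which kills the coordinate `v`. -/
noncomputable def coordKill (v : V) : Matrix V V ℂ :=
  Matrix.diagonal fun w => if w = v then 0 else 1

lemma coordKill_mulVec (v : V) (x : V → ℂ) (w : V) :
    (coordKill v *ᵥ x) w = if w = v then 0 else x w := by
  simp [coordKill, mulVec_diagonal]

lemma coordKill_conjTranspose (v : V) : (coordKill v)ᴴ = coordKill v := by
  ext i j
  by_cases h : i = j
  · subst h; simp [coordKill, conjTranspose_apply, diagonal]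
  · simp [coordKill, conjTranspose_apply, diagonal, h, Ne.symm h]

lemma mulVec_coordKill_of_eq_zero {v : V} {x : V → ℂ} (h : x v = 0) : coordKill v *ᵥ x = x := by
  ext w
  rw [coordKill_mulVec]
  split_ifs with hw
  · rw [hw, h]
  · rfl

lemma coordKill_mulVec_eq_zero_iff {v : V} {x : V → ℂ} :
    coordKill v *ᵥ x = 0 ↔ x = x v • Pi.single v 1 := by
  constructor
  · intro h
    ext w
    have := congrFun h w
    rw [coordKill_mulVec] at this
    by_cases hw : w = v
    · subst hw; simp
    · simpa [hw] using this
  · intro h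
    ext w
    rw [coordKill_mulVec]
    by_cases hw : w = v
    · simp [hw]
    · rw [h]; simp [hw]

/-- Rank-nullity for the projection restricted to the range of `M`: its kernel is the intersection
of that range with the line of e_v, nonzero here and zero in the complementary case below. -/
lemma rank_coordKill_mul_of_range {v : V} {M : Matrix V V ℂ} {z : V → ℂ}
    (hz : M *ᵥ z = Pi.single v 1) : (coordKill v * M).rank + 1 ≤ M.rank := by
  have h1 := LinearMap.finrank_range_add_finrank_ker
    ((coordKill v).mulVecLin.domRestrict (LinearMap.range M.mulVecLin))
  have h2 : LinearMap.range ((coordKill v).mulVecLin.domRestrict (LinearMap.range M.mulVecLin)) =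
      LinearMap.range (coordKill v * M).mulVecLin := by
    rw [LinearMap.range_domRestrict, mulVecLin_mul, LinearMap.range_comp]
  have h3 : 0 < Module.finrank ℂ (LinearMap.ker
      ((coordKill v).mulVecLin.domRestrict (LinearMap.range M.mulVecLin))) := by
    refine Nat.pos_of_ne_zero fun h0 => ?_
    rw [Submodule.finrank_eq_zero, LinearMap.ker_eq_bot'] at h0
    have := congrArg Subtype.val (h0 ⟨Pi.single v 1, z, by simpa using hz⟩ (by
      simp only [LinearMap.domRestrict_apply, mulVecLin_apply]
      rw [coordKill_mulVec_eq_zero_iff]; simp))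
    simpa using congrFun this v
  rw [h2] at h1
  unfold rank
  omega

lemma rank_le_coordKill_mul_of_not_range {v : V} {M : Matrix V V ℂ}
    (hz : ¬ ∃ z, M *ᵥ z = Pi.single v 1) : M.rank ≤ (coordKill v * M).rank := by
  have h1 := LinearMap.finrank_range_add_finrank_ker
    ((coordKill v).mulVecLin.domRestrict (LinearMap.range M.mulVecLin))
  have h2 : LinearMap.range ((coordKill v).mulVecLin.domRestrict (LinearMap.range M.mulVecLin)) =
      LinearMap.range (coordKill v * M).mulVecLin := by
    rw [LinearMap.range_domRestrict, mulVecLin_mul, LinearMap.range_comp]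
  have h3 : LinearMap.ker
      ((coordKill v).mulVecLin.domRestrict (LinearMap.range M.mulVecLin)) = ⊥ := by
    rw [LinearMap.ker_eq_bot']
    rintro ⟨y, x, rfl⟩ h
    simp only [LinearMap.domRestrict_apply, mulVecLin_apply] at h
    rw [coordKill_mulVec_eq_zero_iff] at h
    by_cases h0 : (M *ᵥ x) v = 0
    · ext w
      simp only [mulVecLin_apply, ZeroMemClass.coe_zero]
      rw [h, h0]; simp
    · refine (hz ⟨((M *ᵥ x) v)⁻¹ • x, ?_⟩).elim
      rw [mulVec_smul]
      conv_lhs => rw [h]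
      simp [smul_smul, h0]
  rw [h2, h3, finrank_bot] at h1
  unfold rank
  omega

lemma rank_le_coordKill_mul_add_one (v : V) (M : Matrix V V ℂ) :
    M.rank ≤ (coordKill v * M).rank + 1 := by
  have h1 : M = coordKill v * M + (1 - coordKill v) * M := by
    rw [← add_mul]; simp
  have h2 : (1 - coordKill v : Matrix V V ℂ).rank ≤ 1 := by
    have : (1 - coordKill v : Matrix V V ℂ) = vecMulVec (Pi.single v 1) (Pi.single v 1) := by
      ext i j
      simp only [coordKill, sub_apply, vecMulVec_apply, one_apply, diagonal_apply, Pi.single_apply]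
      split_ifs <;> simp_all
    rw [this]; exact rank_vecMulVec_le _ _
  calc M.rank = (coordKill v * M + (1 - coordKill v) * M).rank := by rw [← h1]
    _ ≤ (coordKill v * M).rank + ((1 - coordKill v) * M).rank := by
        unfold rank
        rw [mulVecLin_add]
        exact (Submodule.finrank_mono (LinearMap.range_add_le _ _)).trans
          (Submodule.finrank_add_le_finrank_add_finrank _ _)
    _ ≤ _ := by gcongr; exact (rank_mul_le_left _ _).trans h2

open scoped ComplexOrder in
lemma rank_mul_coordKill_eq {A : Matrix V V ℂ} (hA : A.IsHermitian) (v : V) :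
    (A * coordKill v).rank = (coordKill v * A).rank := by
  rw [← rank_conjTranspose (A * coordKill v), conjTranspose_mul, coordKill_conjTranspose, hA.eq]

/-- The matrix obtained by zeroing the row and the column `v`. -/
noncomputable def coordCut (v : V) (A : Matrix V V ℂ) : Matrix V V ℂ :=
  coordKill v * (A * coordKill v)

variable {A : Matrix V V ℂ} {v : V}

lemma rank_coordCut_le : (coordCut v A).rank ≤ A.rank :=
  (rank_mul_le_right _ _).trans (rank_mul_le_left _ _)

lemma rank_le_coordCut_add_two (hA : A.IsHermitian) : A.rank ≤ (coordCut v A).rank + 2 := by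
  have h1 := rank_le_coordKill_mul_add_one v A
  have h2 := rank_le_coordKill_mul_add_one v (A * coordKill v)
  rw [rank_mul_coordKill_eq hA] at h2
  unfold coordCut
  omega

/-- Zeroing column v and then row v each costs one dimension: since z_v = 0, the vector e_v is still
in the range after the column has been zeroed. -/
lemma rank_coordCut_of_range (hA : A.IsHermitian) {z : V → ℂ}
    (hz : A *ᵥ z = Pi.single v 1) (h0 : z v = 0) : (coordCut v A).rank + 2 ≤ A.rank := by
  have h1 := rank_coordKill_mul_of_range hz
  have h2 := rank_coordKill_mul_of_range (v := v) (M := A * coordKill v) (z := z)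
    (by rw [← mulVec_mulVec, mulVec_coordKill_of_eq_zero h0, hz])
  rw [rank_mul_coordKill_eq hA] at h2
  unfold coordCut
  omega

lemma exists_of_coordCut_rank (hA : A.IsHermitian) (h : (coordCut v A).rank + 2 ≤ A.rank) :
    ∃ z, A *ᵥ z = Pi.single v 1 ∧ z v = 0 := by
  by_cases hz : ∃ z, (A * coordKill v) *ᵥ z = Pi.single v 1
  · obtain ⟨z, hz⟩ := hz
    refine ⟨coordKill v *ᵥ z, by rw [mulVec_mulVec, hz], by simp [coordKill_mulVec]⟩
  · have h2 := rank_le_coordKill_mul_of_not_range hz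
    have h1 := rank_le_coordKill_mul_add_one v A
    rw [rank_mul_coordKill_eq hA] at h2
    unfold coordCut at h
    omega

/-- If zeroing column v keeps the rank, that column is a combination of the others; the relation is
the null vector. -/
lemma exists_null_of_rank_mul (h : A.rank ≤ (A * coordKill v).rank) :
    ∃ x, A *ᵥ x = 0 ∧ x v ≠ 0 := by
  have hle : LinearMap.range (A * coordKill v).mulVecLin ≤ LinearMap.range A.mulVecLin := by
    rw [mulVecLin_mul]; exact LinearMap.range_comp_le_range _ _
  have heq := Submodule.eq_of_le_of_finrank_le hle h
  have : A *ᵥ Pi.single v 1 ∈ LinearMap.range (A * coordKill v).mulVecLin := by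
    rw [heq]; exact ⟨_, rfl⟩
  obtain ⟨w, hw⟩ := this
  rw [mulVecLin_apply, ← mulVec_mulVec] at hw
  refine ⟨Pi.single v 1 - coordKill v *ᵥ w, by rw [mulVec_sub, hw, sub_self], ?_⟩
  simp [coordKill_mulVec]

lemma exists_null_of_rank_coordCut (h : A.rank ≤ (coordCut v A).rank) :
    ∃ x, A *ᵥ x = 0 ∧ x v ≠ 0 :=
  exists_null_of_rank_mul (h.trans (rank_mul_le_right _ _))

/-- The Fredholm alternative for the right-hand side e_v. -/
lemma exists_null_or_range (hA : A.IsHermitian) (v : V) :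
    (∃ x, A *ᵥ x = 0 ∧ x v ≠ 0) ∨ ∃ z, A *ᵥ z = Pi.single v 1 := by
  by_cases hz : ∃ z, A *ᵥ z = Pi.single v 1
  · exact Or.inr hz
  · refine Or.inl (exists_null_of_rank_mul ?_)
    rw [rank_mul_coordKill_eq hA]
    exact rank_le_coordKill_mul_of_not_range hz

lemma dotProduct_eq_zero_of_null (hA : A.IsHermitian) {x : V → ℂ} (hx : A *ᵥ x = 0) (z : V → ℂ) :
    star x ⬝ᵥ (A *ᵥ z) = 0 := by
  rw [dotProduct_mulVec, ← hA.eq, ← star_mulVec, hx]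
  simp

lemma null_apply_eq_zero (hA : A.IsHermitian) {x z : V → ℂ} (hx : A *ᵥ x = 0) {a : ℂ} (ha : a ≠ 0)
    (hz : A *ᵥ z = a • Pi.single v 1) : x v = 0 := by
  have := dotProduct_eq_zero_of_null hA hx z
  rw [hz] at this
  simpa [ha] using this

lemma rank_le_coordCut_of_null (hA : A.IsHermitian) {x : V → ℂ} (hx : A *ᵥ x = 0) (hv : x v ≠ 0) :
    A.rank ≤ (coordCut v A).rank := by
  have h1 : A.rank ≤ (coordKill v * A).rank := by
    refine rank_le_coordKill_mul_of_not_range ?_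
    rintro ⟨z, hz⟩
    exact hv (null_apply_eq_zero hA hx one_ne_zero (by rw [hz, one_smul]))
  have h2 : (A * coordKill v).rank ≤ (coordKill v * (A * coordKill v)).rank := by
    refine rank_le_coordKill_mul_of_not_range ?_
    rintro ⟨z, hz⟩
    rw [← mulVec_mulVec] at hz
    exact hv (null_apply_eq_zero hA hx one_ne_zero (by rw [hz, one_smul]))
  rw [rank_mul_coordKill_eq hA] at h2
  exact h1.trans h2

end Matrix

/-! ### Cyclic vertices and isolation of vertices -/

namespace SimpleGraph

variable {V : Type*}

/-- A vertex is cyclic if some cycle passes through it. -/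
def IsCyclic (H : SimpleGraph V) (v : V) : Prop := ∃ p : H.Walk v v, p.IsCycle

lemma IsCyclic.of_mem_support {H : SimpleGraph V} {u v : V} {p : H.Walk u u} (hp : p.IsCycle)
    (hv : v ∈ p.support) : H.IsCyclic v := by
  classical exact ⟨p.rotate v hv, hp.rotate hv⟩

lemma IsCyclic.mono {H H' : SimpleGraph V} (h : H ≤ H') {v : V} (hv : H.IsCyclic v) :
    H'.IsCyclic v :=
  let ⟨p, hp⟩ := hv
  ⟨p.mapLe h, hp.mapLe h⟩

/-- Remove all edges which meet `X`; the vertices of `X` become isolated. -/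
def isolate (H : SimpleGraph V) (X : Set V) : SimpleGraph V where
  Adj a b := H.Adj a b ∧ a ∉ X ∧ b ∉ X
  symm := ⟨fun _ _ h => ⟨h.1.symm, h.2.2, h.2.1⟩⟩
  loopless := ⟨fun _ h => h.1.ne rfl⟩

lemma isolate_adj {H : SimpleGraph V} {X : Set V} {a b : V} :
    (H.isolate X).Adj a b ↔ H.Adj a b ∧ a ∉ X ∧ b ∉ X := Iff.rfl

lemma isolate_le (H : SimpleGraph V) (X : Set V) : H.isolate X ≤ H := fun _ _ h => h.1

lemma isolate_isolate (H : SimpleGraph V) (X Y : Set V) :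
    (H.isolate X).isolate Y = H.isolate (X ∪ Y) := by
  ext a b
  simp only [isolate_adj, Set.mem_union]
  tauto

lemma isolate_lt {H : SimpleGraph V} {X : Set V} {a b : V} (h : H.Adj a b) (ha : a ∈ X) :
    H.isolate X < H :=
  lt_of_le_of_ne (isolate_le H X) fun he => (isolate_adj.1 (he.symm.le h)).2.1 ha

lemma IsCyclic.exists_adj {H : SimpleGraph V} {v : V} (hv : H.IsCyclic v) : ∃ w, H.Adj v w :=
  let ⟨p, hp⟩ := hv
  ⟨p.snd, p.adj_snd hp.not_nil⟩

lemma exists_isCycle_isolate {H : SimpleGraph V} {X : Set V} {v : V} {p : H.Walk v v}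
    (hp : p.IsCycle) (h : ∀ w ∈ p.support, w ∉ X) :
    ∃ q : (H.isolate X).Walk v v, q.IsCycle ∧ q.support = p.support ∧ q.edges = p.edges := by
  have he : ∀ e ∈ p.edges, e ∈ (H.isolate X).edgeSet := by
    intro e he
    induction e with
    | _ a b =>
      exact ⟨p.adj_of_mem_edges he, h _ (p.fst_mem_support_of_mem_edges he),
        h _ (p.snd_mem_support_of_mem_edges he)⟩
  exact ⟨p.transfer _ he, hp.transfer he, by simp, by simp⟩

/-- Isolating non-cyclic vertices destroys no cycle. -/
lemma isCyclic_isolate_of_not {H : SimpleGraph V} {X : Set V} (hX : ∀ x ∈ X, ¬ H.IsCyclic x)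
    {v : V} : (H.isolate X).IsCyclic v ↔ H.IsCyclic v := by
  refine ⟨fun h => h.mono (isolate_le H X), fun ⟨p, hp⟩ => ?_⟩
  obtain ⟨q, hq, -, -⟩ := exists_isCycle_isolate (X := X) hp
    fun w hw hwX => hX w hwX (.of_mem_support hp hw)
  exact ⟨q, hq⟩

/-! ### The cyclomatic number under removal of edges -/

section Cyclomatic

variable [Finite V]

lemma card_edgeSet_deleteEdges {H : SimpleGraph V} {e : Sym2 V} (he : e ∈ H.edgeSet) :
    Nat.card (H.deleteEdges {e}).edgeSet + 1 = Nat.card H.edgeSet := by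
  rw [edgeSet_deleteEdges, Nat.card_coe_set_eq, Nat.card_coe_set_eq]
  exact Set.ncard_sdiff_singleton_add_one he (Set.toFinite _)

lemma reachable_or_of_deleteEdges {H : SimpleGraph V} {u v a b : V} (h : H.Reachable a b) :
    (H.deleteEdges {s(u, v)}).Reachable a b ∨
      (H.deleteEdges {s(u, v)}).Reachable u b ∨ (H.deleteEdges {s(u, v)}).Reachable v b := by
  obtain ⟨p⟩ := h
  induction p with
  | nil => exact Or.inl (Reachable.refl _)
  | @cons a c b hac p ih =>
    rcases ih with ih | ih
    · by_cases h : s(a, c) = s(u, v)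
      · rcases Sym2.eq_iff.1 h with ⟨rfl, rfl⟩ | ⟨rfl, rfl⟩
        · exact Or.inr (Or.inr ih)
        · exact Or.inr (Or.inl ih)
      · refine Or.inl (Reachable.trans (Adj.reachable ?_) ih)
        rw [deleteEdges_adj]
        exact ⟨hac, h⟩
    · exact Or.inr ih

lemma card_connectedComponent_deleteEdges_le (H : SimpleGraph V) (e : Sym2 V) :
    Nat.card (H.deleteEdges {e}).ConnectedComponent ≤ Nat.card H.ConnectedComponent + 1 := by
  classical
  induction e with
  | _ u v =>
    set K := H.deleteEdges {s(u, v)}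
    -- Restoring the edge can only merge the components of u and v, so with the component of u sent
    -- to `none` the map on the rest is injective.
    let f : K.ConnectedComponent → Option H.ConnectedComponent := fun c =>
      if c = K.connectedComponentMk u then none
      else some (c.map (Hom.ofLE (deleteEdges_le _)))
    have hf : Function.Injective f := by
      intro c d hcd
      induction c using ConnectedComponent.ind with | _ a
      induction d using ConnectedComponent.ind with | _ b
      simp only [f] at hcd
      split_ifs at hcd with h1 h2
      · rw [h1, h2]
      · simp only [Option.some.injEq] at hcd
        rw [ConnectedComponent.eq] at *
        have hab : H.Reachable a b := ConnectedComponent.eq.1 hcd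
        rcases reachable_or_of_deleteEdges (u := u) (v := v) hab with h | h | h
        · exact h
        · exact absurd h.symm ‹_›
        · rcases reachable_or_of_deleteEdges (u := u) (v := v) hab.symm with h' | h' | h'
          · exact h'.symm
          · exact absurd h'.symm ‹_›
          · exact h'.symm.trans h
    have := Nat.card_le_card_of_injective f hf
    rwa [Finite.card_option] at this

lemma card_connectedComponent_deleteEdges_of_reachable {H : SimpleGraph V} {u v : V}
    (h : (H.deleteEdges {s(u, v)}).Reachable u v) :
    Nat.card (H.deleteEdges {s(u, v)}).ConnectedComponent = Nat.card H.ConnectedComponent := by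
  refine le_antisymm ?_ (ConnectedComponent.card_le_card_of_le (deleteEdges_le _))
  refine Nat.card_le_card_of_injective
    (fun c => c.map (Hom.ofLE (deleteEdges_le {s(u, v)}))) ?_
  intro c d hcd
  induction c using ConnectedComponent.ind with | _ a
  induction d using ConnectedComponent.ind with | _ b
  rw [ConnectedComponent.eq]
  have hab : H.Reachable a b := ConnectedComponent.eq.1 hcd
  rcases reachable_or_of_deleteEdges (u := u) (v := v) hab with h1 | h1 | h1
  · exact h1
  · rcases reachable_or_of_deleteEdges (u := u) (v := v) hab.symm with h2 | h2 | h2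
    · exact h2.symm
    · exact h2.symm.trans h1
    · exact h2.symm.trans (h.symm.trans h1)
  · rcases reachable_or_of_deleteEdges (u := u) (v := v) hab.symm with h2 | h2 | h2
    · exact h2.symm
    · exact h2.symm.trans (h.trans h1)
    · exact h2.symm.trans h1

lemma card_connectedComponent_deleteEdges_of_not_reachable {H : SimpleGraph V} {u v : V}
    (huv : H.Adj u v) (h : ¬ (H.deleteEdges {s(u, v)}).Reachable u v) :
    Nat.card H.ConnectedComponent + 1 ≤ Nat.card (H.deleteEdges {s(u, v)}).ConnectedComponent := by
  classical
  have : Fintype H.ConnectedComponent := Fintype.ofFinite _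
  by_contra hlt
  set K := H.deleteEdges {s(u, v)}
  let f : K.ConnectedComponent → H.ConnectedComponent :=
    fun c => c.map (Hom.ofLE (deleteEdges_le {s(u, v)}))
  have hs : Function.Surjective f := ConnectedComponent.surjective_map_ofLE (deleteEdges_le _)
  have hc : Nat.card K.ConnectedComponent = Nat.card H.ConnectedComponent :=
    le_antisymm (by omega) (Nat.card_le_card_of_surjective f hs)
  have hb : Function.Bijective f := (Nat.bijective_iff_surjective_and_card f).2 ⟨hs, hc⟩
  refine h (ConnectedComponent.eq.1 (hb.1 ?_))
  exact ConnectedComponent.eq.2 huv.reachable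

lemma cyclomaticNumber_deleteEdges_le (H : SimpleGraph V) (e : Sym2 V) :
    (H.deleteEdges {e}).cyclomaticNumber ≤ H.cyclomaticNumber := by
  by_cases he : e ∈ H.edgeSet
  · have h1 := card_edgeSet_deleteEdges he
    have h2 := card_connectedComponent_deleteEdges_le H e
    unfold cyclomaticNumber
    omega
  · rw [deleteEdges_eq_self.2 (by simpa using he)]

lemma cyclomaticNumber_le_deleteEdges_add_one (H : SimpleGraph V) (e : Sym2 V) :
    H.cyclomaticNumber ≤ (H.deleteEdges {e}).cyclomaticNumber + 1 := by
  by_cases he : e ∈ H.edgeSet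
  · have h1 := card_edgeSet_deleteEdges he
    have h2 := ConnectedComponent.card_le_card_of_le (H.deleteEdges_le {e})
    unfold cyclomaticNumber
    omega
  · rw [deleteEdges_eq_self.2 (by simpa using he)]; omega

lemma cyclomaticNumber_deleteEdges_of_isBridge {H : SimpleGraph V} {e : Sym2 V}
    (he : H.IsBridge e) : H.cyclomaticNumber ≤ (H.deleteEdges {e}).cyclomaticNumber := by
  by_cases hm : e ∈ H.edgeSet
  · have h1 := card_edgeSet_deleteEdges hm
    induction e with
    | _ u v =>
      have h2 : Nat.card H.ConnectedComponent + 1 ≤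
          Nat.card (H.deleteEdges {s(u, v)}).ConnectedComponent :=
        card_connectedComponent_deleteEdges_of_not_reachable hm (isBridge_iff.1 he)
      unfold cyclomaticNumber
      omega
  · rw [deleteEdges_eq_self.2 (by simpa using hm)]

lemma cyclomaticNumber_deleteEdges_of_mem_cycle {H : SimpleGraph V} {e : Sym2 V} {v : V}
    {p : H.Walk v v} (hp : p.IsCycle) (he : e ∈ p.edges) :
    (H.deleteEdges {e}).cyclomaticNumber + 1 = H.cyclomaticNumber := by
  have hm : e ∈ H.edgeSet := p.edges_subset_edgeSet he
  have h1 := card_edgeSet_deleteEdges hm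
  have hb : ¬ H.IsBridge e := fun hb => (isBridge_iff_forall_cycle_notMem hm).1 hb p hp he
  induction e with
  | _ a b =>
    rw [isBridge_iff, not_not] at hb
    have h2 := card_connectedComponent_deleteEdges_of_reachable hb
    unfold cyclomaticNumber
    omega

lemma exists_adj_not_adj_of_lt {H' H : SimpleGraph V} (h : H' < H) :
    ∃ a b, H.Adj a b ∧ ¬ H'.Adj a b := by
  by_contra! hc
  exact h.not_ge fun a b hab => hc a b hab

lemma le_deleteEdges_of_not_adj {H' H : SimpleGraph V} (h : H' ≤ H) {a b : V}
    (hab : ¬ H'.Adj a b) : H' ≤ H.deleteEdges {s(a, b)} := by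
  intro c d hcd
  rw [deleteEdges_adj]
  refine ⟨h hcd, fun he => hab ?_⟩
  rw [← mem_edgeSet, ← Set.mem_singleton_iff.1 he]
  exact hcd

lemma deleteEdges_lt_of_adj {H : SimpleGraph V} {a b : V} (hab : H.Adj a b) :
    H.deleteEdges {s(a, b)} < H := by
  refine lt_of_le_of_ne (deleteEdges_le _) fun he => ?_
  have h := he.symm.le hab
  rw [deleteEdges_adj] at h
  exact h.2 rfl

lemma cyclomaticNumber_mono {H' H : SimpleGraph V} (h : H' ≤ H) :
    H'.cyclomaticNumber ≤ H.cyclomaticNumber := by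
  induction H using WellFoundedLT.induction with
  | _ H ih =>
    rcases h.eq_or_lt with rfl | hlt
    · exact le_rfl
    · obtain ⟨a, b, hab, hn⟩ := exists_adj_not_adj_of_lt hlt
      exact (ih _ (deleteEdges_lt_of_adj hab) (le_deleteEdges_of_not_adj h hn)).trans
        (cyclomaticNumber_deleteEdges_le _ _)

/-- An edge outside `H'` lies on no cycle, hence is a bridge, and deleting a bridge does not lower
the cyclomatic number. -/
lemma cyclomaticNumber_le_of_cycles {H' H : SimpleGraph V} (h : H' ≤ H)
    (hc : ∀ (v : V) (p : H.Walk v v), p.IsCycle → ∀ e ∈ p.edges, e ∈ H'.edgeSet) :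
    H.cyclomaticNumber ≤ H'.cyclomaticNumber := by
  induction H using WellFoundedLT.induction with
  | _ H ih =>
    rcases h.eq_or_lt with rfl | hlt
    · exact le_rfl
    · obtain ⟨a, b, hab, hn⟩ := exists_adj_not_adj_of_lt hlt
      have hb : H.IsBridge s(a, b) :=
        (isBridge_iff_forall_cycle_notMem hab).2 fun v p hp he => hn (hc v p hp _ he)
      refine (cyclomaticNumber_deleteEdges_of_isBridge hb).trans
        (ih _ (deleteEdges_lt_of_adj hab) (le_deleteEdges_of_not_adj h hn) fun v p hp e he => ?_)
      exact hc v (p.mapLe (deleteEdges_le _)) (hp.mapLe _) e (by simpa using he)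

lemma cyclomaticNumber_bot : (⊥ : SimpleGraph V).cyclomaticNumber = 0 := by
  have h : Nat.card V = Nat.card (⊥ : SimpleGraph V).ConnectedComponent := by
    refine Nat.card_congr (Equiv.ofBijective (connectedComponentMk ⊥) ⟨fun a b h => ?_, fun c => ?_⟩)
    · exact reachable_bot.1 (ConnectedComponent.eq.1 h)
    · induction c using ConnectedComponent.ind with | _ a
      exact ⟨a, rfl⟩
  simp [cyclomaticNumber, h]

lemma cyclomaticNumber_eq_zero_of_forall_not_isCyclic {H : SimpleGraph V}
    (h : ∀ v, ¬ H.IsCyclic v) : H.cyclomaticNumber = 0 := by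
  refine le_antisymm ?_ ?_
  · rw [← cyclomaticNumber_bot (V := V)]
    exact cyclomaticNumber_le_of_cycles bot_le fun v p hp => (h v ⟨p, hp⟩).elim
  · rw [← cyclomaticNumber_bot (V := V)]
    exact cyclomaticNumber_mono bot_le

/-- One edge at v on a cycle is already responsible for the drop; monotonicity handles the other
edges at v. -/
lemma cyclomaticNumber_isolate_of_isCyclic {H : SimpleGraph V} {v : V} (hv : H.IsCyclic v) :
    (H.isolate {v}).cyclomaticNumber + 1 ≤ H.cyclomaticNumber := by
  obtain ⟨p, hp⟩ := hv
  have he : s(v, p.snd) ∈ p.edges := by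
    rw [← p.cons_tail_eq hp.not_nil]; simp
  rw [← cyclomaticNumber_deleteEdges_of_mem_cycle hp he]
  gcongr
  refine cyclomaticNumber_mono (le_deleteEdges_of_not_adj (isolate_le H _) ?_)
  simp [isolate_adj]

lemma Walk.mem_edges_of_closed {H : SimpleGraph V} {x y : V} (r : H.Walk x y) {S : Set V}
    {T : Set (Sym2 V)} (hx : x ∈ S)
    (h : ∀ a b, s(a, b) ∈ r.edges → a ∈ S → s(a, b) ∈ T ∧ b ∈ S) : ∀ e ∈ r.edges, e ∈ T := by
  induction r with
  | nil => simp
  | cons hadj r ih =>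
    have h1 := h _ _ (by rw [edges_cons]; exact List.mem_cons_self) hx
    intro e he
    rw [edges_cons, List.mem_cons] at he
    rcases he with rfl | he
    · exact h1.1
    · exact ih h1.2 (fun a b hab => h a b (by simp [hab])) e he

/-- Going around p from the common vertex, some edge ab leaves q at a vertex a of q. Deleting ab
destroys p and lowers the number by 1; a still lies on q, so isolating it lowers the number again.
-/
lemma exists_cyclomaticNumber_isolate_of_edge {H : SimpleGraph V} {u w v : V} {p : H.Walk u u}
    {q : H.Walk w w} (hp : p.IsCycle) (hq : q.IsCycle) (hvp : v ∈ p.support) (hvq : v ∈ q.support)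
    {e : Sym2 V} (hep : e ∈ p.edges) (heq : e ∉ q.edges) :
    ∃ a, H.IsCyclic a ∧ (H.isolate {a}).cyclomaticNumber + 2 ≤ H.cyclomaticNumber := by
  classical
  obtain ⟨a, b, hab, ha, hn⟩ : ∃ a b, s(a, b) ∈ p.edges ∧ a ∈ q.support ∧ s(a, b) ∉ q.edges := by
    by_contra! hc
    refine heq ((p.rotate v hvp).mem_edges_of_closed (S := {a | a ∈ q.support})
      (T := {e | e ∈ q.edges}) hvq (fun a b hab ha => ?_) e
      ((p.rotate_edges v hvp).perm.mem_iff.2 hep))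
    have h1 := hc a b ((p.rotate_edges v hvp).perm.mem_iff.1 hab) ha
    exact ⟨h1, q.snd_mem_support_of_mem_edges h1⟩
  have h1 := cyclomaticNumber_deleteEdges_of_mem_cycle hp hab
  have hqt : ∀ e ∈ q.edges, e ∈ (H.deleteEdges {s(a, b)}).edgeSet := by
    intro e he
    rw [edgeSet_deleteEdges]
    exact ⟨q.edges_subset_edgeSet he, fun h => hn (Set.mem_singleton_iff.1 h ▸ he)⟩
  have hcyc : (H.deleteEdges {s(a, b)}).IsCyclic a :=
    .of_mem_support (hq.transfer hqt) (by simpa using ha)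
  have h2 := cyclomaticNumber_isolate_of_isCyclic hcyc
  have h3 : (H.isolate {a}).cyclomaticNumber ≤
      ((H.deleteEdges {s(a, b)}).isolate {a}).cyclomaticNumber := by
    refine cyclomaticNumber_mono fun c d hcd => ⟨?_, hcd.2⟩
    exact le_deleteEdges_of_not_adj (isolate_le H _) (by simp [isolate_adj]) hcd
  exact ⟨a, .of_mem_support hq ha, by omega⟩

end Cyclomatic

/-- Any two cycles of `H` which share a vertex have the same edges. -/
def DisjointCycles (H : SimpleGraph V) : Prop :=
  ∀ ⦃u w v : V⦄ ⦃p : H.Walk u u⦄ ⦃q : H.Walk w w⦄, p.IsCycle → q.IsCycle → v ∈ p.support →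
    v ∈ q.support → ∀ e ∈ p.edges, e ∈ q.edges

lemma DisjointCycles.mono {H' H : SimpleGraph V} (h : H' ≤ H) (hd : H.DisjointCycles) :
    H'.DisjointCycles := by
  intro u w v p q hp hq hvp hvq e he
  simpa using hd (hp.mapLe h) (hq.mapLe h) (v := v) (by simpa using hvp) (by simpa using hvq) e
    (by simpa using he)

lemma DisjointCycles.support_subset {H : SimpleGraph V} (hd : H.DisjointCycles) {u w v : V}
    {p : H.Walk u u} {q : H.Walk w w} (hp : p.IsCycle) (hq : q.IsCycle) (hvp : v ∈ p.support)
    (hvq : v ∈ q.support) : ∀ x ∈ p.support, x ∈ q.support := by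
  intro x hx
  rw [Walk.mem_support_iff_exists_mem_edges_of_not_nil hp.not_nil] at hx
  rw [Walk.mem_support_iff_exists_mem_edges_of_not_nil hq.not_nil]
  obtain ⟨e, he, hxe⟩ := hx
  exact ⟨e, hd hp hq hvp hvq e he, hxe⟩

/-! ### Counting disjoint cycles -/

section Transversal

variable [Finite V]

/-- With disjoint cycles, the cyclomatic number is the size of any set of vertices which meets
every cycle exactly once. -/
lemma DisjointCycles.cyclomaticNumber_eq_card {H : SimpleGraph V} (hd : H.DisjointCycles)
    {X : Finset V} (hX : ∀ x ∈ X, H.IsCyclic x)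
    (hX1 : ∀ (u : V) (p : H.Walk u u), p.IsCycle → ∃ x ∈ X, x ∈ p.support)
    (hX2 : ∀ (u : V) (p : H.Walk u u), p.IsCycle → ∀ x ∈ X, ∀ y ∈ X, x ∈ p.support →
      y ∈ p.support → x = y) : H.cyclomaticNumber = X.card := by
  classical
  induction X using Finset.induction_on generalizing H with
  | empty =>
    simp only [Finset.card_empty, Nat.cast_zero]
    refine cyclomaticNumber_eq_zero_of_forall_not_isCyclic fun v ⟨p, hp⟩ => ?_
    simpa using hX1 v p hp
  | insert x X hx ih =>
    obtain ⟨p, hp⟩ := hX x (by simp)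
    have he : s(x, p.snd) ∈ p.edges := by
      rw [← p.cons_tail_eq hp.not_nil]; simp
    have hle : H.deleteEdges {s(x, p.snd)} ≤ H := deleteEdges_le _
    -- By disjointness a cycle through x contains every edge of p, in particular the deleted one.
    have hxr : ∀ (u : V) (r : (H.deleteEdges {s(x, p.snd)}).Walk u u), r.IsCycle →
        x ∉ r.support := by
      intro u r hr hxr
      have := hd hp (hr.mapLe hle) p.start_mem_support (by simpa using hxr) _ he
      have h2 := r.edges_subset_edgeSet (by simpa using this)
      rw [edgeSet_deleteEdges] at h2
      exact h2.2 rfl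
    rw [Finset.card_insert_of_notMem hx, ← cyclomaticNumber_deleteEdges_of_mem_cycle hp he,
      ih (hd.mono hle)]
    · push_cast; rfl
    · intro y hy
      obtain ⟨q, hq⟩ := hX y (by simp [hy])
      refine ⟨q.transfer _ fun e heq => ?_, hq.transfer _⟩
      rw [edgeSet_deleteEdges]
      refine ⟨q.edges_subset_edgeSet heq, fun h => ?_⟩
      rw [Set.mem_singleton_iff] at h
      subst h
      have := hX2 y q hq x (by simp) y (by simp [hy]) (q.fst_mem_support_of_mem_edges heq)
        q.start_mem_support
      exact hx (this ▸ hy)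
    · intro u r hr
      obtain ⟨y, hy, hyr⟩ := hX1 u (r.mapLe hle) (hr.mapLe hle)
      have hyr : y ∈ r.support := by simpa using hyr
      rcases Finset.mem_insert.1 hy with rfl | hy
      · exact (hxr u r hr hyr).elim
      · exact ⟨y, hy, hyr⟩
    · intro u r hr y hy z hz hyr hzr
      exact hX2 u (r.mapLe hle) (hr.mapLe hle) y (by simp [hy]) z (by simp [hz])
        (by simpa using hyr) (by simpa using hzr)

end Transversal

/-! ### Independence number -/

section Independence

variable [Finite V]

lemma isIndepSet_iff_not_adj {H : SimpleGraph V} {S : Set V} :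
    H.IsIndepSet S ↔ ∀ a ∈ S, ∀ b ∈ S, ¬ H.Adj a b :=
  ⟨fun h _ ha _ hb hab => h ha hb hab.ne hab, fun h a ha b hb _ => h a ha b hb⟩

lemma exists_isIndepSet_card_eq (H : SimpleGraph V) :
    ∃ S : Finset V, (∀ a ∈ S, ∀ b ∈ S, ¬ H.Adj a b) ∧ S.card = H.indepNum := by
  have : Fintype V := Fintype.ofFinite V
  obtain ⟨S, hS⟩ := H.exists_isNIndepSet_indepNum
  exact ⟨S, by simpa using isIndepSet_iff_not_adj.1 hS.1, hS.2⟩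

lemma card_le_indepNum {H : SimpleGraph V} {S : Finset V} (h : ∀ a ∈ S, ∀ b ∈ S, ¬ H.Adj a b) :
    S.card ≤ H.indepNum :=
  IsIndepSet.card_le_indepNum (isIndepSet_iff_not_adj.2 (by simpa using h))

lemma indepNum_anti {H' H : SimpleGraph V} (h : H' ≤ H) : H.indepNum ≤ H'.indepNum := by
  obtain ⟨S, hS, hc⟩ := H.exists_isIndepSet_card_eq
  rw [← hc]
  exact card_le_indepNum fun a ha b hb hab => hS a ha b hb (h hab)

lemma indepNum_isolate_le (H : SimpleGraph V) (v : V) :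
    (H.isolate {v}).indepNum ≤ H.indepNum + 1 := by
  classical
  obtain ⟨S, hS, hc⟩ := (H.isolate {v}).exists_isIndepSet_card_eq
  have h1 : (S.erase v).card ≤ H.indepNum := by
    refine card_le_indepNum fun a ha b hb hab => ?_
    rw [Finset.mem_erase] at ha hb
    exact hS a ha.2 b hb.2 ⟨hab, ha.1, hb.1⟩
  have h2 := Finset.pred_card_le_card_erase (s := S) (a := v)
  omega

end Independence

end SimpleGraph

/-! ### Forests, masked matrices and the defect -/

namespace SimpleGraph

variable {V : Type*}

lemma Walk.mem_support_of_closed {H : SimpleGraph V} {x y : V} (r : H.Walk x y) {S : Set V}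
    (hx : x ∈ S) (h : ∀ a b, s(a, b) ∈ r.edges → a ∈ S → b ∈ S) : ∀ w ∈ r.support, w ∈ S := by
  induction r with
  | nil => simpa using hx
  | cons hadj r ih =>
    have h1 := h _ _ (by rw [edges_cons]; exact List.mem_cons_self) hx
    intro w hw
    rw [support_cons, List.mem_cons] at hw
    rcases hw with rfl | hw
    · exact hx
    · exact ih h1 (fun a b hab => h a b (by simp [hab])) w hw

/-- A finite graph with an edge but without cycles has a leaf. -/
lemma exists_leaf [Finite V] {H : SimpleGraph V} (hc : ∀ v, ¬ H.IsCyclic v) {a b : V}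
    (hab : H.Adj a b) : ∃ v u, H.Adj v u ∧ ∀ w, H.Adj v w → w = u := by
  classical
  have : Fintype V := Fintype.ofFinite V
  by_contra! hl
  -- Without leaves the first vertex of a path has a second neighbour, which either closes a cycle
  -- or prolongs the path; so paths would be arbitrarily long.
  have key : ∀ n : ℕ, ∃ (u v : V) (p : H.Walk u v), p.IsPath ∧ p.length = n + 1 := by
    intro n
    induction n with
    | zero => exact ⟨a, b, .cons hab .nil, by simp [hab.ne], rfl⟩
    | succ n ih =>
      obtain ⟨u, v, p, hp, hn⟩ := ih
      have hnil : ¬ p.Nil := by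
        rw [← Walk.length_eq_zero_iff]; omega
      obtain ⟨w, huw, hw⟩ := hl u p.snd (p.adj_snd hnil)
      by_cases hs : w ∈ p.support
      · refine (hc w ⟨.cons huw.symm (p.takeUntil w hs), ?_⟩).elim
        rw [Walk.cons_isCycle_iff]
        refine ⟨hp.takeUntil hs, fun he => hw ?_⟩
        have he := p.edges_takeUntil_subset_edges hs he
        refine (hp.snd_of_toSubgraph_adj ?_).symm
        rw [Walk.adj_toSubgraph_iff_mem_edges, Sym2.eq_swap]
        exact he
      · exact ⟨w, v, .cons huw.symm p, by simp [hp, hs], by simp [hn]⟩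
  obtain ⟨u, v, p, hp, hn⟩ := key (Fintype.card V)
  have := hp.length_lt
  omega

/-- A Hermitian matrix all of whose entries have modulus `1`. -/
structure IsUnitHermitian (W : Matrix V V ℂ) : Prop where
  isHermitian : W.IsHermitian
  norm_eq : ∀ u v, ‖W u v‖ = 1

lemma IsUnitHermitian.ne_zero {W : Matrix V V ℂ} (hW : IsUnitHermitian W) (u v : V) :
    W u v ≠ 0 := by
  have := hW.norm_eq u v
  intro h; simp [h] at this

open Classical in
/-- The entries of `W` at the edges of `H`. -/
noncomputable def mask (W : Matrix V V ℂ) (H : SimpleGraph V) : Matrix V V ℂ :=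
  Matrix.of fun u v => if H.Adj u v then W u v else 0

open Classical in
lemma mask_apply (W : Matrix V V ℂ) (H : SimpleGraph V) (a b : V) :
    mask W H a b = if H.Adj a b then W a b else 0 := rfl

lemma mask_isHermitian {W : Matrix V V ℂ} (hW : IsUnitHermitian W) (H : SimpleGraph V) :
    (mask W H).IsHermitian := by
  ext a b
  rw [conjTranspose_apply, mask_apply, mask_apply, H.adj_comm]
  split_ifs
  · exact hW.isHermitian.apply a b
  · simp

variable [Fintype V] [DecidableEq V] {W : Matrix V V ℂ}

open Classical in
lemma mask_mulVec (H : SimpleGraph V) (x : V → ℂ) (a : V) :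
    (mask W H *ᵥ x) a = ∑ b, if H.Adj a b then W a b * x b else 0 := by
  simp only [mulVec, dotProduct, mask_apply]
  exact Finset.sum_congr rfl fun b _ => by split_ifs <;> simp

lemma mask_isolate (H : SimpleGraph V) (v : V) :
    mask W (H.isolate {v}) = coordCut v (mask W H) := by
  ext a b
  simp only [coordCut, coordKill, diagonal_mul, mul_diagonal, mask_apply]
  by_cases ha : a = v
  · simp [isolate_adj, ha]
  by_cases hb : b = v
  · simp [isolate_adj, hb]
  simp only [ha, hb, if_false, one_mul, mul_one]
  classical exact if_congr (by simp [isolate_adj, ha, hb]) rfl rfl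

/-- The excess `r + 2c + 2α - 2n` of the rank over the general lower bound. -/
noncomputable def defect (W : Matrix V V ℂ) (H : SimpleGraph V) : ℤ :=
  (mask W H).rank + 2 * H.cyclomaticNumber + 2 * H.indepNum - 2 * Fintype.card V

/-- Isolating the neighbour u of a leaf v lowers the rank by exactly 2 and raises α by exactly 1. -/
lemma defect_eq_zero_of_forall_not_isCyclic (hW : IsUnitHermitian W) {H : SimpleGraph V}
    (hH : ∀ v, ¬ H.IsCyclic v) : defect W H = 0 := by
  induction H using WellFoundedLT.induction with
  | _ H ih =>
    have hc := cyclomaticNumber_eq_zero_of_forall_not_isCyclic hH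
    by_cases he : ∃ a b, H.Adj a b
    · obtain ⟨a, b, hab⟩ := he
      obtain ⟨v, u, hvu, hv⟩ := exists_leaf hH hab
      have hH' : ∀ w, ¬ (H.isolate {u}).IsCyclic w := fun w hw => hH w (hw.mono (isolate_le _ _))
      have h0 := ih _ (isolate_lt hvu.symm (Set.mem_singleton u)) hH'
      have hc' := cyclomaticNumber_eq_zero_of_forall_not_isCyclic hH'
      have hα := H.indepNum_isolate_le u
      have hα' : H.indepNum + 1 ≤ (H.isolate {u}).indepNum := by
        obtain ⟨S, hS, hcard⟩ := H.exists_isIndepSet_card_eq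
        have hnv : ∀ w, ¬ (H.isolate {u}).Adj v w := fun w hw => hw.2.2 (hv w hw.1)
        have hnu : ∀ w, ¬ (H.isolate {u}).Adj u w := fun w hw => hw.2.1 rfl
        -- Both u and v are isolated in the new graph, and `S` contains at most one of them, so the
        -- other can be added.
        by_cases hu : u ∈ S
        · have hvS : v ∉ S := fun hvS => hS v hvS u hu hvu
          rw [← hcard, ← Finset.card_insert_of_notMem hvS]
          refine card_le_indepNum fun c hc d hd hcd => ?_
          rcases Finset.mem_insert.1 hc with rfl | hc
          · exact hnv _ hcd
          rcases Finset.mem_insert.1 hd with rfl | hd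
          · exact hnv _ hcd.symm
          exact hS c hc d hd hcd.1
        · rw [← hcard, ← Finset.card_insert_of_notMem hu]
          refine card_le_indepNum fun c hc d hd hcd => ?_
          rcases Finset.mem_insert.1 hc with rfl | hc
          · exact hnu _ hcd
          rcases Finset.mem_insert.1 hd with rfl | hd
          · exact hnu _ hcd.symm
          exact hS c hc d hd hcd.1
      have hr : (coordCut u (mask W H)).rank + 2 ≤ (mask W H).rank := by
        -- The column of the leaf v has its only nonzero entry at u.
        refine rank_coordCut_of_range (mask_isHermitian hW H) (z := Pi.single v (W u v)⁻¹) ?_ ?_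
        · ext c
          rw [mulVec_single]
          simp only [MulOpposite.smul_eq_mul_unop, MulOpposite.unop_op, Pi.smul_apply, col_apply,
            mask_apply]
          by_cases hcu : c = u
          · subst hcu
            simp [hvu.symm, hW.ne_zero]
          · rw [if_neg fun h => hcu (hv c h.symm)]
            simp [hcu]
        · simp [hvu.ne.symm]
      have hr' := rank_le_coordCut_add_two (v := u) (mask_isHermitian hW H)
      rw [← mask_isolate] at hr hr'
      unfold defect at *
      omega
    · push Not at he
      have hm : mask W H = 0 := by
        ext a b
        rw [mask_apply, if_neg (he a b)]; rfl
      have h1 : Fintype.card V ≤ H.indepNum :=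
        card_le_indepNum (S := Finset.univ) fun a _ b _ => he a b
      obtain ⟨S, -, hS⟩ := H.exists_isIndepSet_card_eq
      have h2 := S.card_le_univ
      unfold defect
      rw [hm, rank_zero]
      omega

lemma defect_isolate_le (W : Matrix V V ℂ) {H : SimpleGraph V} {v : V} (hv : H.IsCyclic v) :
    defect W (H.isolate {v}) ≤ defect W H := by
  have h1 := cyclomaticNumber_isolate_of_isCyclic hv
  have h2 := H.indepNum_isolate_le v
  have h3 : (mask W (H.isolate {v})).rank ≤ (mask W H).rank := by
    rw [mask_isolate]; exact rank_coordCut_le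
  unfold defect
  omega

lemma defect_nonneg (hW : IsUnitHermitian W) (H : SimpleGraph V) : 0 ≤ defect W H := by
  induction H using WellFoundedLT.induction with
  | _ H ih =>
    by_cases h : ∃ v, H.IsCyclic v
    · obtain ⟨v, hv⟩ := h
      obtain ⟨w, hw⟩ := hv.exists_adj
      exact (ih _ (isolate_lt hw (Set.mem_singleton v))).trans (defect_isolate_le W hv)
    · push Not at h
      exact (defect_eq_zero_of_forall_not_isCyclic hW h).ge

lemma defect_isolate_eq_zero (hW : IsUnitHermitian W) {H : SimpleGraph V} (hd : defect W H = 0)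
    {v : V} (hv : H.IsCyclic v) : defect W (H.isolate {v}) = 0 :=
  le_antisymm (hd ▸ defect_isolate_le W hv) (defect_nonneg hW _)

lemma indepNum_isolate_eq (hW : IsUnitHermitian W) {H : SimpleGraph V} (hd : defect W H = 0)
    {v : V} (hv : H.IsCyclic v) : (H.isolate {v}).indepNum = H.indepNum + 1 := by
  have h1 := cyclomaticNumber_isolate_of_isCyclic hv
  have h2 := H.indepNum_isolate_le v
  have h3 : (mask W (H.isolate {v})).rank ≤ (mask W H).rank := by
    rw [mask_isolate]; exact rank_coordCut_le
  have h4 := defect_isolate_eq_zero hW hd hv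
  unfold defect at *
  omega

/-- Defect 0 on both sides of the isolation leaves no room for the rank to fall, and a constant rank
produces the null vector. -/
lemma exists_null_of_isCyclic (hW : IsUnitHermitian W) {H : SimpleGraph V} (hd : defect W H = 0)
    {v : V} (hv : H.IsCyclic v) : ∃ x, mask W H *ᵥ x = 0 ∧ x v ≠ 0 := by
  have h1 := cyclomaticNumber_isolate_of_isCyclic hv
  have h2 := H.indepNum_isolate_le v
  have h4 := defect_isolate_eq_zero hW hd hv
  refine exists_null_of_rank_coordCut ?_
  rw [← mask_isolate]
  unfold defect at *
  omega

lemma disjointCycles_of_defect_eq_zero (hW : IsUnitHermitian W) {H : SimpleGraph V}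
    (hd : defect W H = 0) : H.DisjointCycles := by
  intro u w v p q hp hq hvp hvq e hep
  by_contra heq
  obtain ⟨a, ha, hc⟩ := exists_cyclomaticNumber_isolate_of_edge hp hq hvp hvq hep heq
  have h2 := H.indepNum_isolate_le a
  have h3 : (mask W (H.isolate {a})).rank ≤ (mask W H).rank := by
    rw [mask_isolate]; exact rank_coordCut_le
  have h4 := defect_isolate_eq_zero hW hd ha
  unfold defect at *
  omega

/-- If `e_y = A z` with `z_y = 0`, isolating `y` keeps the defect zero. -/
lemma defect_isolate_of_range (hW : IsUnitHermitian W) {H : SimpleGraph V} (hd : defect W H = 0)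
    {y : V} (hz : ∃ z, mask W H *ᵥ z = Pi.single y 1 ∧ z y = 0) :
    defect W (H.isolate {y}) = 0 ∧ (H.isolate {y}).indepNum = H.indepNum + 1 ∧
      (mask W (H.isolate {y})).rank + 2 = (mask W H).rank := by
  obtain ⟨z, hz, hy⟩ := hz
  have h1 := rank_coordCut_of_range (mask_isHermitian hW H) hz hy
  have h1' := rank_le_coordCut_add_two (v := y) (mask_isHermitian hW H)
  rw [← mask_isolate] at h1 h1'
  have h2 := H.indepNum_isolate_le y
  have h3 := cyclomaticNumber_mono (H.isolate_le {y})
  have h4 := defect_nonneg hW (H.isolate {y})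
  unfold defect at *
  omega

/-! ### Bridges at cyclic vertices -/

/-- `Q` is one side of the bridge `uy` of `H`, with `y ∈ Q` and `u ∉ Q`. -/
structure IsBridgeSide (H : SimpleGraph V) (u y : V) (Q : Set V) : Prop where
  adj : H.Adj u y
  notMem : u ∉ Q
  mem : y ∈ Q
  eq_of_adj : ∀ ⦃a⦄, a ∈ Q → ∀ ⦃b⦄, b ∉ Q → H.Adj a b → a = y ∧ b = u

lemma exists_isBridgeSide {H : SimpleGraph V} {u y : V} (h : H.Adj u y)
    (hb : H.IsBridge s(u, y)) : ∃ Q, H.IsBridgeSide u y Q := by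
  rw [isBridge_iff] at hb
  refine ⟨{w | (H.deleteEdges {s(u, y)}).Reachable y w}, h, fun hu => hb (Reachable.symm hu),
    Reachable.refl _, fun a ha b hb' hab => ?_⟩
  by_contra hne
  refine hb' (Reachable.trans ha (Adj.reachable ?_))
  rw [deleteEdges_adj]
  refine ⟨hab, fun he => ?_⟩
  rcases Sym2.eq_iff.1 (Set.mem_singleton_iff.1 he) with ⟨rfl, rfl⟩ | h
  · exact hb (Reachable.symm ha)
  · exact hne h

namespace IsBridgeSide

variable {H : SimpleGraph V} {u y : V} {Q : Set V}

open Classical in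
lemma mask_mulVec_of_support (hs : H.IsBridgeSide u y Q) {x : V → ℂ} (hx : ∀ b ∉ Q, x b = 0) :
    mask W H *ᵥ x = mask W (H.isolate Qᶜ) *ᵥ x + Pi.single u (W u y * x y) := by
  ext a
  rw [Pi.add_apply, mask_mulVec, mask_mulVec]
  by_cases ha : a ∈ Q
  · have hau : a ≠ u := fun h => hs.notMem (h ▸ ha)
    rw [Pi.single_eq_of_ne hau, add_zero]
    refine Finset.sum_congr rfl fun b _ => ?_
    by_cases hb : b ∈ Q
    · simp [isolate_adj, ha, hb]
    · simp [hx b hb]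
  · have h0 : ∀ b, ¬ (H.isolate Qᶜ).Adj a b := fun b hb => hb.2.1 ha
    simp only [h0, if_false, Finset.sum_const_zero, zero_add]
    rw [Finset.sum_eq_single y]
    · by_cases hau : a = u
      · subst hau; simp [hs.adj]
      · rw [Pi.single_eq_of_ne hau, if_neg]
        exact fun h => hau (hs.eq_of_adj hs.mem ha h.symm).2
    · intro b _ hby
      by_cases hb : b ∈ Q
      · rw [if_neg]
        exact fun h => hby (hs.eq_of_adj hb ha h.symm).1
      · simp [hx b hb]
    · simp

open Classical in
lemma mask_isolate_compl_mulVec (hs : H.IsBridgeSide u y Q) {x : V → ℂ}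
    (hx : mask W (H.isolate {u}) *ᵥ x = 0) : mask W (H.isolate Qᶜ) *ᵥ x = 0 := by
  ext a
  have h := congrFun hx a
  rw [mask_mulVec] at h ⊢
  by_cases ha : a ∈ Q
  · rw [← h]
    refine Finset.sum_congr rfl fun b _ => if_congr ?_ rfl rfl
    simp only [isolate_adj, Set.mem_compl_iff, not_not, Set.mem_singleton_iff]
    refine ⟨fun h => ⟨h.1, fun h' => hs.notMem (h' ▸ ha), fun h' => hs.notMem (h' ▸ h.2.2)⟩,
      fun h => ⟨h.1, ha, ?_⟩⟩
    by_contra hb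
    exact h.2.2 (hs.eq_of_adj ha hb h.1).2
  · exact Finset.sum_eq_zero fun b _ => if_neg fun h => h.2.1 ha

open Classical in
lemma mask_isolate_mulVec (hs : H.IsBridgeSide u y Q) {x : V → ℂ}
    (hx : mask W (H.isolate {y}) *ᵥ x = 0) : mask W (H.isolate Q) *ᵥ x = 0 := by
  ext a
  have h := congrFun hx a
  rw [mask_mulVec] at h ⊢
  by_cases ha : a ∈ Q
  · exact Finset.sum_eq_zero fun b _ => if_neg fun h => h.2.1 ha
  · rw [← h]
    refine Finset.sum_congr rfl fun b _ => if_congr ?_ rfl rfl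
    simp only [isolate_adj, Set.mem_singleton_iff]
    refine ⟨fun h => ⟨h.1, fun h' => ha (h' ▸ hs.mem), fun h' => h.2.2 (h' ▸ hs.mem)⟩,
      fun h => ⟨h.1, ha, fun hb => ?_⟩⟩
    exact h.2.2 (hs.eq_of_adj hb ha h.1.symm).1

open Classical in
-- Cutting off `Q` removes a single term from the equations outside `Q`, the contribution of y at u.
lemma mask_isolate_mulVec_of_null (hs : H.IsBridgeSide u y Q) {x : V → ℂ}
    (hx : mask W H *ᵥ x = 0) :
    mask W (H.isolate Q) *ᵥ x = (-(W u y * x y)) • Pi.single u 1 := by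
  ext a
  have h := congrFun hx a
  rw [mask_mulVec] at h ⊢
  by_cases ha : a ∈ Q
  · rw [Finset.sum_eq_zero fun b _ => if_neg fun h => h.2.1 ha]
    have hau : a ≠ u := fun h => hs.notMem (h ▸ ha)
    simp [hau]
  · have key : ∀ b, (if H.Adj a b then W a b * x b else 0) =
        (if (H.isolate Q).Adj a b then W a b * x b else 0) +
          if b = y then (Pi.single u (W u y * x y) : V → ℂ) a else 0 := by
      intro b
      by_cases hby : b = y
      · subst hby
        have : ¬ (H.isolate Q).Adj a b := fun h => h.2.2 hs.mem
        rw [if_neg this, if_pos rfl, zero_add]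
        by_cases hau : a = u
        · subst hau; simp [hs.adj]
        · rw [Pi.single_eq_of_ne hau, if_neg]
          exact fun h => hau (hs.eq_of_adj hs.mem ha h.symm).2
      · rw [if_neg hby, add_zero]
        refine if_congr ?_ rfl rfl
        rw [isolate_adj]
        exact ⟨fun h => ⟨h, ha, fun hb => hby (hs.eq_of_adj hb ha h.symm).1⟩, fun h => h.1⟩
    rw [Finset.sum_congr rfl fun b _ => key b, Finset.sum_add_distrib] at h
    simp only [Finset.sum_ite_eq', Finset.mem_univ, if_true] at h
    rw [eq_neg_of_add_eq_zero_left h]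
    by_cases hau : a = u
    · subst hau; simp
    · simp [hau]

open Classical in
lemma mask_isolate_indicator (H : SimpleGraph V) (Q : Set V) (x : V → ℂ) :
    mask W (H.isolate Qᶜ) *ᵥ (Q.indicator x) = mask W (H.isolate Qᶜ) *ᵥ x := by
  ext a
  rw [mask_mulVec, mask_mulVec]
  refine Finset.sum_congr rfl fun b _ => ?_
  by_cases hb : b ∈ Q
  · simp [hb]
  · rw [if_neg fun h => h.2.2 hb, if_neg fun h => h.2.2 hb]

/-- The vectors of the side `Q` carry over to `H`, up to an error at `u`. -/
lemma mask_mulVec_indicator (hs : H.IsBridgeSide u y Q) (x : V → ℂ) :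
    mask W H *ᵥ (Q.indicator x) =
      mask W (H.isolate Qᶜ) *ᵥ x + (W u y * x y) • Pi.single u 1 := by
  rw [hs.mask_mulVec_of_support fun b hb => Set.indicator_of_notMem hb x, mask_isolate_indicator,
    Set.indicator_of_mem hs.mem]
  congr 1
  ext a
  by_cases h : a = u
  · subst h; simp
  · simp [h]

/-- Extended by zero, x would be mapped to a nonzero multiple of e_u, which is orthogonal to the
null vector existing at the cyclic vertex u only if that vector vanishes there. -/
lemma null_apply_eq_zero (hW : IsUnitHermitian W) (hs : H.IsBridgeSide u y Q)
    (hd : defect W H = 0) (hu : H.IsCyclic u) {x : V → ℂ}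
    (hx : mask W (H.isolate Qᶜ) *ᵥ x = 0) : x y = 0 := by
  by_contra hy
  obtain ⟨w, hw, hwu⟩ := exists_null_of_isCyclic hW hd hu
  have h := hs.mask_mulVec_indicator (W := W) x
  rw [hx, zero_add] at h
  exact hwu (Matrix.null_apply_eq_zero (mask_isHermitian hW H) hw
    (mul_ne_zero (hW.ne_zero u y) hy) h)

lemma isBridge (hs : H.IsBridgeSide u y Q) : H.IsBridge s(u, y) := by
  rw [isBridge_iff]
  rintro ⟨r⟩
  refine hs.notMem (r.reverse.mem_support_of_closed (S := Q) hs.mem (fun a b hab ha => ?_) u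
    (by simp))
  by_contra hb
  have hadj := r.reverse.adj_of_mem_edges hab
  rw [deleteEdges_adj] at hadj
  obtain ⟨rfl, rfl⟩ := hs.eq_of_adj ha hb hadj.1
  exact hadj.2 Sym2.eq_swap

lemma notMem_support (hs : H.IsBridgeSide u y Q) {v : V} {p : H.Walk v v} (hp : p.IsCycle)
    (hy : y ∈ p.support) : u ∉ p.support := by
  intro hu
  have hr := hp.rotate hy
  refine hs.notMem ((p.rotate y hy).mem_support_of_closed (S := Q) hs.mem (fun a b hab ha => ?_) u
    (by simpa using hu))
  by_contra hb
  obtain ⟨rfl, rfl⟩ := hs.eq_of_adj ha hb ((p.rotate y hy).adj_of_mem_edges hab)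
  rw [Sym2.eq_swap] at hab
  exact (isBridge_iff_forall_cycle_notMem hs.adj).1 hs.isBridge _ hr hab

/-- No bridge joins two cyclic vertices. -/
lemma not_isCyclic (hW : IsUnitHermitian W) (hs : H.IsBridgeSide u y Q)
    (hd : defect W H = 0) (hu : H.IsCyclic u) : ¬ H.IsCyclic y := by
  rintro ⟨p, hp⟩
  have hup := hs.notMem_support hp p.start_mem_support
  obtain ⟨q, hq, -, -⟩ := exists_isCycle_isolate (X := {u}) hp
    fun w hw h => hup (Set.mem_singleton_iff.1 h ▸ hw)
  obtain ⟨x, hx, hxy⟩ := exists_null_of_isCyclic hW (defect_isolate_eq_zero hW hd hu) ⟨q, hq⟩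
  exact hxy (hs.null_apply_eq_zero hW hd hu (hs.mask_isolate_compl_mulVec hx))

end IsBridgeSide

end SimpleGraph

namespace SimpleGraph

variable {V : Type*} [Fintype V] [DecidableEq V] {W : Matrix V V ℂ}

namespace IsBridgeSide

variable {H : SimpleGraph V} {u y : V} {Q : Set V}

/-- A cycle through u could enter `Q` only through y, which lies on no cycle. -/
lemma isCyclic_of_isolate (hs : H.IsBridgeSide u y Q) (hy : ¬ H.IsCyclic y) {X : Set V}
    (hX : X ⊆ Q) (hu : H.IsCyclic u) : (H.isolate X).IsCyclic u := by
  obtain ⟨p, hp⟩ := hu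
  have hQ := p.mem_support_of_closed (S := Qᶜ) hs.notMem fun a b hab ha hb => by
    obtain ⟨rfl, rfl⟩ := hs.eq_of_adj hb ha (p.adj_of_mem_edges hab).symm
    exact hy (.of_mem_support hp (p.snd_mem_support_of_mem_edges hab))
  obtain ⟨q, hq, -, -⟩ := exists_isCycle_isolate (X := X) hp fun w hw h => hQ w hw (hX h)
  exact ⟨q, hq⟩

/-- If the side `Q` of the bridge is acyclic, `e_y = A z` for some `z` with `z_y = 0`. -/
lemma exists_range_of_acyclic (hW : IsUnitHermitian W) (hs : H.IsBridgeSide u y Q)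
    (hd : defect W H = 0) (hu : H.IsCyclic u) (hQ : ∀ v ∈ Q, ¬ H.IsCyclic v) :
    ∃ z, mask W H *ᵥ z = Pi.single y 1 ∧ z y = 0 := by
  have hK : ∀ v, ¬ (H.isolate Qᶜ).IsCyclic v := by
    intro v hv
    obtain ⟨w, hw⟩ := hv.exists_adj
    exact hQ v (not_not.1 hw.2.1) (hv.mono (isolate_le _ _))
  have hK' : ∀ v, ¬ ((H.isolate Qᶜ).isolate {y}).IsCyclic v :=
    fun v hv => hK v (hv.mono (isolate_le _ _))
  have h1 := defect_eq_zero_of_forall_not_isCyclic hW hK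
  have h2 := defect_eq_zero_of_forall_not_isCyclic hW hK'
  have h3 := cyclomaticNumber_eq_zero_of_forall_not_isCyclic hK
  have h4 := cyclomaticNumber_eq_zero_of_forall_not_isCyclic hK'
  have h5 : ¬ (mask W (H.isolate Qᶜ)).rank ≤ (mask W ((H.isolate Qᶜ).isolate {y})).rank := by
    intro hle
    rw [mask_isolate] at hle
    obtain ⟨x, hx, hxy⟩ := exists_null_of_rank_coordCut hle
    exact hxy (hs.null_apply_eq_zero hW hd hu hx)
  -- Forests have even rank 2n − 2α, so a strict drop is a drop by at least 2.
  have h6 : (mask W ((H.isolate Qᶜ).isolate {y})).rank + 2 ≤ (mask W (H.isolate Qᶜ)).rank := by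
    unfold defect at h1 h2
    omega
  rw [mask_isolate] at h6
  obtain ⟨z, hz, hzy⟩ := exists_of_coordCut_rank (mask_isHermitian hW _) h6
  refine ⟨Q.indicator z, ?_, by rw [Set.indicator_of_mem hs.mem, hzy]⟩
  rw [hs.mask_mulVec_indicator, hz, hzy]
  simp

/-- The side of the bridge which contains the cyclic vertex `u` has a null vector which does not
vanish at `u`. -/
lemma exists_null_isolate (hW : IsUnitHermitian W) (hs : H.IsBridgeSide u y Q)
    (hd : defect W H = 0) (hu : H.IsCyclic u) :
    ∃ x, mask W (H.isolate Q) *ᵥ x = 0 ∧ x u ≠ 0 := by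
  induction H using WellFoundedLT.induction with
  | _ H ih =>
    have hy := hs.not_isCyclic hW hd hu
    -- Cyclic vertices of `Q` are isolated one at a time; this preserves defect 0 and the other
    -- side, and reduces to an acyclic `Q`.
    by_cases hQ : ∃ v ∈ Q, H.IsCyclic v
    · obtain ⟨v, hvQ, hv⟩ := hQ
      obtain ⟨w, hw⟩ := hv.exists_adj
      have hyv : y ≠ v := fun h => hy (h ▸ hv)
      have huv : u ≠ v := fun h => hs.notMem (h ▸ hvQ)
      have hs' : (H.isolate {v}).IsBridgeSide u y Q :=
        ⟨⟨hs.adj, huv, hyv⟩, hs.notMem, hs.mem, fun a ha b hb hab => hs.eq_of_adj ha hb hab.1⟩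
      have hvQ' : {v} ⊆ Q := Set.singleton_subset_iff.2 hvQ
      have := ih _ (isolate_lt hw (Set.mem_singleton v)) hs' (defect_isolate_eq_zero hW hd hv)
        (hs.isCyclic_of_isolate hy hvQ' hu)
      rwa [isolate_isolate, Set.union_eq_self_of_subset_left hvQ'] at this
    · push Not at hQ
      have hd' := (defect_isolate_of_range hW hd (hs.exists_range_of_acyclic hW hd hu hQ)).1
      obtain ⟨x, hx, hxu⟩ := exists_null_of_isCyclic hW hd'
        (hs.isCyclic_of_isolate hy (Set.singleton_subset_iff.2 hs.mem) hu)
      exact ⟨x, hs.mask_isolate_mulVec hx, hxu⟩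

/-- The alternative on the side `Q` gives z with image e_y there. If z_y ≠ 0, orthogonality to a
null vector w of the whole graph with w_u ≠ 0 forces w_y ≠ 0; then e_u lies in the range on the
other side, contradicting `exists_null_isolate`. -/
lemma exists_range (hW : IsUnitHermitian W) (hs : H.IsBridgeSide u y Q)
    (hd : defect W H = 0) (hu : H.IsCyclic u) :
    ∃ z, mask W H *ᵥ z = Pi.single y 1 ∧ z y = 0 := by
  have hA := mask_isHermitian hW H
  rcases exists_null_or_range (mask_isHermitian hW (H.isolate Qᶜ)) y with ⟨x, hx, hxy⟩ | ⟨z, hz⟩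
  · exact (hxy (hs.null_apply_eq_zero hW hd hu hx)).elim
  have hz' := hs.mask_mulVec_indicator (W := W) z
  rw [hz] at hz'
  have hzy : z y = 0 := by
    by_contra hzy
    obtain ⟨w, hw, hwu⟩ := exists_null_of_isCyclic hW hd hu
    obtain ⟨x, hx, hxu⟩ := hs.exists_null_isolate hW hd hu
    have h1 := dotProduct_eq_zero_of_null hA hw (Q.indicator z)
    rw [hz', dotProduct_add, dotProduct_smul, dotProduct_single, dotProduct_single] at h1
    simp only [Pi.star_apply, mul_one, smul_eq_mul] at h1
    have hwy : w y ≠ 0 := by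
      intro h
      rw [h, star_zero, zero_add] at h1
      exact mul_ne_zero (mul_ne_zero (hW.ne_zero u y) hzy) (star_ne_zero.2 hwu) h1
    exact hxu (Matrix.null_apply_eq_zero (mask_isHermitian hW _) hx
      (neg_ne_zero.2 (mul_ne_zero (hW.ne_zero u y) hwy)) (hs.mask_isolate_mulVec_of_null hw))
  refine ⟨Q.indicator z, ?_, by rw [Set.indicator_of_mem hs.mem, hzy]⟩
  rw [hz', hzy]
  simp

/-- Deleting the bridge between a cyclic vertex and its other end keeps the defect zero. -/
lemma defect_deleteEdges (hW : IsUnitHermitian W) (hs : H.IsBridgeSide u y Q)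
    (hd : defect W H = 0) (hu : H.IsCyclic u) :
    defect W (H.deleteEdges {s(u, y)}) = 0 ∧
      (H.deleteEdges {s(u, y)}).indepNum = H.indepNum := by
  obtain ⟨hd1, hα1, hr1⟩ := defect_isolate_of_range hW hd (hs.exists_range hW hd hu)
  set K := H.deleteEdges {s(u, y)}
  have hKadj : ∀ {a b}, K.Adj a b ↔ H.Adj a b ∧ s(a, b) ≠ s(u, y) := by
    intro a b; rw [deleteEdges_adj]; simp
  have hKH : K ≤ H := deleteEdges_le _
  have hKy : K.isolate {y} = H.isolate {y} := by
    ext a b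
    simp only [isolate_adj, hKadj, Set.mem_singleton_iff]
    refine ⟨fun h => ⟨h.1.1, h.2⟩, fun h => ⟨⟨h.1, fun he => ?_⟩, h.2⟩⟩
    rcases Sym2.eq_iff.1 he with ⟨-, rfl⟩ | ⟨rfl, -⟩
    · exact h.2.2 rfl
    · exact h.2.1 rfl
  have hr : (mask W K).rank ≤ (mask W H).rank := by
    have := rank_le_coordCut_add_two (v := y) (mask_isHermitian hW K)
    rw [← mask_isolate, hKy] at this
    omega
  have hc := cyclomaticNumber_mono hKH
  -- Only a set `S` containing both u and y is at issue. It is compared with a maximum independent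
  -- set of `H` isolated at y that avoids u, and the parts of the two sets in `Q` are exchanged.
  have hα : K.indepNum ≤ H.indepNum := by
    obtain ⟨S, hS, hcard⟩ := K.exists_isIndepSet_card_eq
    by_cases huS : u ∈ S ∧ y ∈ S
    · obtain ⟨huS, hyS⟩ := huS
      have hu1 : (H.isolate {y}).IsCyclic u := hs.isCyclic_of_isolate
        (hs.not_isCyclic hW hd hu) (Set.singleton_subset_iff.2 hs.mem) hu
      have hα2 := indepNum_isolate_eq hW hd1 hu1
      obtain ⟨T, hT, hTc⟩ := ((H.isolate {y}).isolate {u}).exists_isIndepSet_card_eq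
      classical
      -- `T \ {u}` is a maximum independent set of `H` isolated at `y`
      have hTe : (H.isolate {y}).indepNum ≤ (T.erase u).card := by
        have := Finset.pred_card_le_card_erase (s := T) (a := u)
        omega
      have hTi : ∀ a ∈ T.erase u, ∀ b ∈ T.erase u, ¬ (H.isolate {y}).Adj a b := by
        intro a ha b hb hab
        rw [Finset.mem_erase] at ha hb
        exact hT a ha.2 b hb.2 ⟨hab, ha.1, hb.1⟩
      have hnoQ : ∀ a ∈ Q, ∀ b ∉ Q, ¬ (H.isolate {y}).Adj a b := fun a ha b hb hab =>
        hab.2.1 (hs.eq_of_adj ha hb hab.1).1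
      have h1 : ((S.filter (· ∉ Q)) ∪ ((T.erase u).filter (· ∈ Q))).card ≤
          (H.isolate {y}).indepNum := by
        refine card_le_indepNum fun a ha b hb hab => ?_
        simp only [Finset.mem_union, Finset.mem_filter] at ha hb
        rcases ha with ha | ha <;> rcases hb with hb | hb
        · exact hS a ha.1 b hb.1 (isolate_le K {y} (hKy ▸ hab))
        · exact hnoQ b hb.2 a ha.2 hab.symm
        · exact hnoQ a ha.2 b hb.2 hab
        · exact hTi a ha.1 b hb.1 hab
      rw [Finset.card_union_of_disjoint (Finset.disjoint_left.2 fun a ha hb => by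
        simp only [Finset.mem_filter] at ha hb; tauto)] at h1
      have h2 := Finset.card_filter_add_card_filter_not (s := T.erase u) (· ∈ Q)
      have h3 := Finset.card_filter_add_card_filter_not (s := S) (· ∈ Q)
      have h4 : (((T.erase u).filter (· ∉ Q)) ∪ (S.filter (· ∈ Q))).card ≤ H.indepNum := by
        refine card_le_indepNum fun a ha b hb hab => ?_
        simp only [Finset.mem_union, Finset.mem_filter] at ha hb
        rcases ha with ha | ha <;> rcases hb with hb | hb
        · exact hTi a ha.1 b hb.1 ⟨hab, fun h => ha.2 (Set.mem_singleton_iff.1 h ▸ hs.mem),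
            fun h => hb.2 (Set.mem_singleton_iff.1 h ▸ hs.mem)⟩
        · exact Finset.ne_of_mem_erase ha.1 (hs.eq_of_adj hb.2 ha.2 hab.symm).2
        · exact Finset.ne_of_mem_erase hb.1 (hs.eq_of_adj ha.2 hb.2 hab).2
        · refine hS a ha.1 b hb.1 (hKadj.2 ⟨hab, fun he => ?_⟩)
          rcases Sym2.eq_iff.1 he with ⟨rfl, -⟩ | ⟨-, rfl⟩
          · exact hs.notMem ha.2
          · exact hs.notMem hb.2
      rw [Finset.card_union_of_disjoint (Finset.disjoint_left.2 fun a ha hb => by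
        simp only [Finset.mem_filter] at ha hb; tauto)] at h4
      omega
    · rw [← hcard]
      refine card_le_indepNum fun a ha b hb hab => hS a ha b hb (hKadj.2 ⟨hab, fun he => huS ?_⟩)
      rcases Sym2.eq_iff.1 he with ⟨rfl, rfl⟩ | ⟨rfl, rfl⟩
      · exact ⟨ha, hb⟩
      · exact ⟨hb, ha⟩
  have hα' := indepNum_anti hKH
  have h0 := defect_nonneg hW K
  unfold defect at *
  omega

end IsBridgeSide

lemma exists_isBridgeSide_of_not_mem_edges {H : SimpleGraph V} (hdis : H.DisjointCycles)
    {u w y : V} {p : H.Walk w w} (hp : p.IsCycle) (hup : u ∈ p.support) (huy : H.Adj u y)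
    (he : s(u, y) ∉ p.edges) : ∃ Q, H.IsBridgeSide u y Q := by
  refine exists_isBridgeSide huy ((isBridge_iff_forall_cycle_notMem huy).2 fun v q hq heq => he ?_)
  exact hdis hq hp (q.fst_mem_support_of_mem_edges heq) hup _ heq

lemma exists_isBridgeSide_of_not_isCyclic {H : SimpleGraph V} {u y : V} (huy : H.Adj u y)
    (hy : ¬ H.IsCyclic y) : ∃ Q, H.IsBridgeSide u y Q := by
  refine exists_isBridgeSide huy ((isBridge_iff_forall_cycle_notMem huy).2 fun v q hq heq => hy ?_)
  exact .of_mem_support hq (q.snd_mem_support_of_mem_edges heq)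

/-! ### Separating the cycles from the rest -/

/-- All edges between cyclic and non-cyclic vertices can be deleted. -/
lemma exists_le_separated (hW : IsUnitHermitian W) {H : SimpleGraph V} (hd : defect W H = 0) :
    ∃ H₀ ≤ H, defect W H₀ = 0 ∧ H₀.indepNum = H.indepNum ∧
      (∀ (v : V) (p : H.Walk v v), p.IsCycle → ∀ e ∈ p.edges, e ∈ H₀.edgeSet) ∧
      ∀ a b, H₀.Adj a b → H.IsCyclic a → H.IsCyclic b := by
  induction H using WellFoundedLT.induction with
  | _ H ih =>
    by_cases h : ∃ u y, H.Adj u y ∧ H.IsCyclic u ∧ ¬ H.IsCyclic y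
    · obtain ⟨u, y, huy, hu, hy⟩ := h
      obtain ⟨Q, hs⟩ := exists_isBridgeSide_of_not_isCyclic huy hy
      obtain ⟨h1, h2⟩ := hs.defect_deleteEdges hW hd hu
      obtain ⟨H₀, hle, h3, h4, h5, h6⟩ := ih _ (deleteEdges_lt_of_adj huy) h1
      have hc : ∀ (v : V) (p : H.Walk v v), p.IsCycle →
          ∀ e ∈ p.edges, e ∈ (H.deleteEdges {s(u, y)}).edgeSet := by
        intro v p hp e he
        rw [edgeSet_deleteEdges]
        refine ⟨p.edges_subset_edgeSet he, fun h => hy ?_⟩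
        rw [Set.mem_singleton_iff.1 h] at he
        exact .of_mem_support hp (p.snd_mem_support_of_mem_edges he)
      have hcyc : ∀ v, (H.deleteEdges {s(u, y)}).IsCyclic v ↔ H.IsCyclic v := fun v =>
        ⟨fun h => h.mono (deleteEdges_le _), fun ⟨p, hp⟩ => ⟨_, hp.transfer (hc v p hp)⟩⟩
      refine ⟨H₀, hle.trans (deleteEdges_le _), h3, h4.trans h2, fun v p hp e he => ?_, ?_⟩
      · exact h5 v _ (hp.transfer (hc v p hp)) e (by simpa using he)
      · intro a b hab
        rw [← hcyc, ← hcyc]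
        exact h6 a b hab
    · push Not at h
      exact ⟨H, le_rfl, hd, rfl, fun v p hp e he => p.edges_subset_edgeSet he, h⟩

/-- Isolating non-cyclic neighbours of cyclic vertices increases the independence number by one
each time. -/
lemma le_indepNum_isolate (hW : IsUnitHermitian W) {H : SimpleGraph V} (hd : defect W H = 0)
    (N : Finset V) (hN : ∀ y ∈ N, ¬ H.IsCyclic y ∧ ∃ u, H.Adj u y ∧ H.IsCyclic u) :
    H.indepNum + N.card ≤ (H.isolate N).indepNum := by
  induction N using Finset.induction_on generalizing H with
  | empty => exact indepNum_anti (isolate_le _ _)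
  | insert y N hy ih =>
    obtain ⟨hyc, u, huy, hu⟩ := hN y (by simp)
    obtain ⟨Q, hs⟩ := exists_isBridgeSide_of_not_isCyclic huy hyc
    obtain ⟨h1, h2, -⟩ := defect_isolate_of_range hW hd (hs.exists_range hW hd hu)
    have hcyc : ∀ v, (H.isolate {y}).IsCyclic v ↔ H.IsCyclic v := fun v =>
      isCyclic_isolate_of_not fun x hx => Set.mem_singleton_iff.1 hx ▸ hyc
    have := ih h1 fun z hz => by
      obtain ⟨hzc, w, hwz, hw⟩ := hN z (by simp [hz])
      refine ⟨by rwa [hcyc], w, ⟨hwz, ?_, ?_⟩, by rwa [hcyc]⟩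
      · exact fun h => hyc (Set.mem_singleton_iff.1 h ▸ hw)
      · exact fun h => hy (Set.mem_singleton_iff.1 h ▸ hz)
    rw [isolate_isolate] at this
    rw [Finset.card_insert_of_notMem hy, Finset.coe_insert, Set.insert_eq]
    omega

/-- In a graph of defect zero, some maximum independent set of the non-cyclic vertices has no
neighbour among the cyclic vertices. -/
lemma exists_indepSet_of_defect_eq_zero (hW : IsUnitHermitian W) {H : SimpleGraph V}
    (hd : defect W H = 0) :
    ∃ S : Finset V, (∀ a ∈ S, ¬ H.IsCyclic a) ∧ (∀ a ∈ S, ∀ b ∈ S, ¬ H.Adj a b) ∧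
      (∀ a ∈ S, ∀ b, H.Adj a b → ¬ H.IsCyclic b) ∧
      ∀ I : Finset V, (∀ a ∈ I, ¬ H.IsCyclic a) → (∀ a ∈ I, ∀ b ∈ I, ¬ H.Adj a b) →
        I.card ≤ S.card := by
  classical
  obtain ⟨H₀, hle, -, hα, -, hsep⟩ := exists_le_separated hW hd
  set N : Finset V := Finset.univ.filter fun y => ¬ H.IsCyclic y ∧ ∃ u, H.Adj u y ∧ H.IsCyclic u
  have h1 := le_indepNum_isolate hW hd N (fun y hy => (Finset.mem_filter.1 hy).2)
  obtain ⟨M, hM, hMc⟩ := (H.isolate N).exists_isIndepSet_card_eq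
  have hMN : ∀ a ∈ M \ N, ∀ b ∈ M \ N, ¬ H.Adj a b := by
    intro a ha b hb hab
    rw [Finset.mem_sdiff] at ha hb
    exact hM a ha.1 b hb.1 ⟨hab, by simpa using ha.2, by simpa using hb.2⟩
  refine ⟨(M \ N).filter fun a => ¬ H.IsCyclic a, fun a ha => (Finset.mem_filter.1 ha).2,
    fun a ha b hb => hMN a (Finset.mem_filter.1 ha).1 b (Finset.mem_filter.1 hb).1,
    fun a ha b hab hb => ?_, fun I hI hI' => ?_⟩
  · rw [Finset.mem_filter, Finset.mem_sdiff] at ha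
    exact ha.1.2 (Finset.mem_filter.2 ⟨Finset.mem_univ _, ha.2, b, hab.symm, hb⟩)
  -- `H₀` has no edge between cyclic and non-cyclic vertices, so `I` can replace the non-cyclic part
  -- of `M \ N`, whose size is already at least α(`H`) = α(`H₀`).
  · have h2 : (I ∪ (M \ N).filter fun a => H.IsCyclic a).card ≤ H₀.indepNum := by
      refine card_le_indepNum fun a ha b hb hab => ?_
      simp only [Finset.mem_union, Finset.mem_filter] at ha hb
      rcases ha with ha | ha <;> rcases hb with hb | hb
      · exact hI' a ha b hb (hle hab)
      · exact hI a ha (hsep b a hab.symm hb.2)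
      · exact hI b hb (hsep a b hab ha.2)
      · exact hMN a ha.1 b hb.1 (hle hab)
    rw [Finset.card_union_of_disjoint (Finset.disjoint_left.2 fun a ha hb =>
        hI a ha (Finset.mem_filter.1 hb).2)] at h2
    have h3 : ((M \ N).filter fun a => H.IsCyclic a).card +
        ((M \ N).filter fun a => ¬ H.IsCyclic a).card = (M \ N).card :=
      Finset.card_filter_add_card_filter_not _
    have h2' : I.card + ((M \ N).filter fun a => H.IsCyclic a).card ≤ H₀.indepNum := h2
    have h4 := Finset.le_card_sdiff N M
    omega

end SimpleGraph

/-! ### The recurrence around a cycle -/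

/-- The condition on the gain `g` of a cycle of length `l` for the cycle to have maximal nullity. -/
def SingularGain (l : ℕ) (g : ℂ) : Prop :=
  (Even l ∧ g = (-1) ^ (l / 2)) ∨ (Odd l ∧ ((-1) ^ ((l - 1) / 2) * g).re = 0)

lemma Complex.re_eq_zero_of_sq_eq_neg_one {z : ℂ} (h : z ^ 2 = -1) : z.re = 0 := by
  have h1 := congrArg Complex.re h
  have h2 := congrArg Complex.im h
  simp only [pow_two, Complex.mul_re, Complex.mul_im, Complex.neg_re, Complex.neg_im,
    Complex.one_re, Complex.one_im] at h1 h2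
  by_contra h0
  have : z.im = 0 := by
    have : z.re * z.im = 0 := by linarith
    exact (mul_eq_zero.1 this).resolve_left h0
  rw [this] at h1
  nlinarith [sq_nonneg z.re]

lemma Complex.sq_eq_neg_one_of_re_eq_zero {z : ℂ} (h : z.re = 0) (hn : ‖z‖ = 1) : z ^ 2 = -1 := by
  have h1 : z.im * z.im = 1 := by
    have := Complex.normSq_apply z
    rw [Complex.normSq_eq_norm_sq, hn, h] at this
    linarith
  apply Complex.ext <;> simp [pow_two, h, h1]

/-- For even l the relation at 0 determines g. For l = 2m + 1 the relations at 0 and 1 combine to g²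
= −1, so g, up to sign, is purely imaginary. -/
lemma singularGain_of_sequence {l : ℕ} {g : ℂ} {y : ℕ → ℂ} (hy : ∀ i, y (i + 2) = -y i)
    (hg : ∀ i, y (i + l) = g * y i) (h0 : y 0 ≠ 0) : SingularGain l g := by
  have heven : ∀ k i, y (i + 2 * k) = (-1) ^ k * y i := by
    intro k
    induction k with
    | zero => simp
    | succ k ih =>
      intro i
      rw [show i + 2 * (k + 1) = i + 2 * k + 2 by ring, hy, ih]; ring
  rcases Nat.even_or_odd' l with ⟨m, rfl | rfl⟩
  · refine Or.inl ⟨even_two_mul m, ?_⟩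
    rw [Nat.mul_div_cancel_left _ two_pos]
    have := hg 0
    rw [heven] at this
    exact (mul_right_cancel₀ h0 this).symm
  · refine Or.inr ⟨odd_two_mul_add_one m, ?_⟩
    rw [Nat.add_sub_cancel, Nat.mul_div_cancel_left _ two_pos]
    apply Complex.re_eq_zero_of_sq_eq_neg_one
    have h1 := hg 0
    have h2 := hg 1
    rw [show 0 + (2 * m + 1) = 1 + 2 * m by ring, heven] at h1
    rw [show 1 + (2 * m + 1) = 0 + 2 * (m + 1) by ring, heven] at h2
    have hs : ((-1 : ℂ) ^ m) * (-1) ^ m = 1 := by rw [← mul_pow]; simp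
    apply mul_right_cancel₀ h0
    rw [pow_succ] at h2
    linear_combination (-((-1) ^ m) ^ 2 * g) * h1 - ((-1) ^ m) ^ 3 * h2 -
      y 0 * (((-1) ^ m) ^ 2 + 1) * hs

lemma exists_sequence_of_singularGain {l : ℕ} {g : ℂ} (hn : ‖g‖ = 1) (h : SingularGain l g) :
    ∃ y : ℕ → ℂ, (∀ i, y (i + 2) = -y i) ∧ (∀ i, y (i + l) = g * y i) ∧ y 0 ≠ 0 := by
  -- The sequence is determined by y 0 = 1 and y 1 = t, and the twisted periodicity need only be
  -- checked at 0 and 1. For even l take t = 0; for odd l the relation at 0 dictates t.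
  obtain ⟨t, ht0, ht1⟩ : ∃ t : ℂ,
      (-1) ^ (l / 2) * (if Even l then 1 else t) = g ∧
      (-1) ^ ((1 + l) / 2) * (if Even (1 + l) then 1 else t) = g * t := by
    rcases h with ⟨he, hg⟩ | ⟨ho, hg⟩
    · refine ⟨0, ?_, ?_⟩
      · rw [if_pos he, hg, mul_one]
      · rw [if_neg (by rw [Nat.not_even_iff_odd, add_comm]; exact he.add_one)]; simp
    · obtain ⟨m, rfl⟩ := ho
      rw [Nat.add_sub_cancel, Nat.mul_div_cancel_left _ two_pos] at hg
      have hs : ((-1 : ℂ) ^ m) * (-1) ^ m = 1 := by rw [← mul_pow]; simp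
      have h2 := Complex.sq_eq_neg_one_of_re_eq_zero hg (by simp [hn])
      refine ⟨(-1) ^ m * g, ?_, ?_⟩
      · rw [if_neg (by simp), show (2 * m + 1) / 2 = m by omega]
        linear_combination g * hs
      · rw [if_pos (by simp [parity_simps]), show (1 + (2 * m + 1)) / 2 = m + 1 by omega, pow_succ]
        linear_combination (-(-1) ^ m) * h2 + (-1) ^ m * g ^ 2 * hs
  have hy2 : ∀ i : ℕ, (-1 : ℂ) ^ ((i + 2) / 2) * (if Even (i + 2) then 1 else t) =
      -((-1) ^ (i / 2) * (if Even i then 1 else t)) := by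
    intro i
    rw [Nat.add_div_right _ two_pos, pow_succ]
    have : Even (i + 2) ↔ Even i := by simp [parity_simps]
    simp only [this]
    ring
  refine ⟨fun i => (-1) ^ (i / 2) * (if Even i then 1 else t), hy2, fun i => ?_, by simp⟩
  induction i using Nat.twoStepInduction with
  | zero => simpa using ht0
  | one => simpa using ht1
  | more i ih _ =>
    have h1 := hy2 (i + l)
    have h2 := hy2 i
    simp only at ih ⊢
    rw [show i + 2 + l = i + l + 2 by ring, h1, h2, ih]
    ring

/-! ### Null vectors on a cycle component -/

namespace SimpleGraph

variable {V : Type*} {W : Matrix V V ℂ} {H : SimpleGraph V}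

/-- The product of the entries of `W` along the first `i` edges of a sequence of vertices. -/
noncomputable def seqProd (W : Matrix V V ℂ) (f : ℕ → V) (i : ℕ) : ℂ :=
  ∏ j ∈ Finset.range i, W (f j) (f (j + 1))

lemma IsUnitHermitian.conj_mul {W : Matrix V V ℂ} (hW : IsUnitHermitian W) (u v : V) :
    conj (W u v) * W u v = 1 := by
  rw [← Complex.normSq_eq_conj_mul_self, Complex.normSq_eq_norm_sq, hW.norm_eq]; simp

lemma IsUnitHermitian.symm_apply {W : Matrix V V ℂ} (hW : IsUnitHermitian W) (u v : V) :
    W v u = conj (W u v) := (hW.isHermitian.apply v u).symm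

lemma norm_seqProd (hW : IsUnitHermitian W) (f : ℕ → V) (i : ℕ) : ‖seqProd W f i‖ = 1 := by
  simp [seqProd, hW.norm_eq]

lemma conj_seqProd_mul (hW : IsUnitHermitian W) (f : ℕ → V) (i : ℕ) :
    conj (seqProd W f i) * seqProd W f i = 1 := by
  rw [← Complex.normSq_eq_conj_mul_self, Complex.normSq_eq_norm_sq, norm_seqProd hW]; simp

lemma seqProd_succ (W : Matrix V V ℂ) (f : ℕ → V) (i : ℕ) :
    seqProd W f (i + 1) = seqProd W f i * W (f i) (f (i + 1)) := Finset.prod_range_succ _ _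

/-- `f` winds around a cycle of length `l` which is a connected component of `H`. -/
structure IsCyclicSequence (H : SimpleGraph V) (l : ℕ) (f : ℕ → V) : Prop where
  pos : 0 < l
  eq_iff : ∀ i j, f i = f j ↔ i ≡ j [MOD l]
  ne : ∀ i, f i ≠ f (i + 2)
  adj_iff : ∀ i b, H.Adj (f (i + 1)) b ↔ b = f i ∨ b = f (i + 2)

namespace IsCyclicSequence

variable {l : ℕ} {f : ℕ → V}

lemma periodic (hf : H.IsCyclicSequence l f) (i : ℕ) : f (i + l) = f i :=
  (hf.eq_iff _ _).2 (by simp [Nat.ModEq])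

lemma seqProd_add (hf : H.IsCyclicSequence l f) (i : ℕ) :
    seqProd W f (i + l) = seqProd W f l * seqProd W f i := by
  rw [seqProd, add_comm, Finset.prod_range_add]
  congr 1
  refine Finset.prod_congr rfl fun j _ => ?_
  rw [show l + j = j + l by ring, show j + l + 1 = j + 1 + l by ring, hf.periodic, hf.periodic]

variable [Fintype V] [DecidableEq V]

lemma mask_mulVec (hf : H.IsCyclicSequence l f) (x : V → ℂ) (i : ℕ) :
    (mask W H *ᵥ x) (f (i + 1)) = W (f (i + 1)) (f i) * x (f i) +
      W (f (i + 1)) (f (i + 2)) * x (f (i + 2)) := by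
  classical
  rw [SimpleGraph.mask_mulVec, ← Finset.sum_filter]
  have : (Finset.univ.filter fun b => H.Adj (f (i + 1)) b) = {f i, f (i + 2)} := by
    ext b
    simp [hf.adj_iff]
  rw [Finset.filter_congr_decidable, this, Finset.sum_pair (hf.ne i)]

/-- The component has a null vector not vanishing at `f 0` iff its gain is singular. -/
lemma exists_null_iff (hW : IsUnitHermitian W) (hf : H.IsCyclicSequence l f) :
    (∃ x, mask W H *ᵥ x = 0 ∧ x (f 0) ≠ 0) ↔ SingularGain l (seqProd W f l) := by
  constructor
  · rintro ⟨x, hx, hx0⟩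
    -- Multiplying by the partial gains turns all edge weights into 1, at the price of the factor g
    -- after one turn.
    refine singularGain_of_sequence (y := fun i => seqProd W f i * x (f i)) (fun i => ?_)
      (fun i => ?_) (by simpa [seqProd] using hx0)
    · have h := hf.mask_mulVec (W := W) x i
      rw [hx, Pi.zero_apply, hW.symm_apply (f i) (f (i + 1))] at h
      have h1 := hW.conj_mul (f i) (f (i + 1))
      simp only [seqProd_succ]
      linear_combination (-seqProd W f i * W (f i) (f (i + 1))) * h -
        (seqProd W f i * x (f i)) * h1
    · simp only [hf.seqProd_add, hf.periodic]
      ring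
  · intro h
    obtain ⟨y, hy2, hyl, hy0⟩ := exists_sequence_of_singularGain (norm_seqProd hW f l) h
    classical
    set F : ℕ → ℂ := fun i => conj (seqProd W f i) * y i with hF
    have hper : Function.Periodic F l := by
      intro i
      have := conj_seqProd_mul hW f l
      simp only [hF, hf.seqProd_add, hyl, map_mul]
      linear_combination (conj (seqProd W f i) * y i) * this
    have hFeq : ∀ i j, f i = f j → F i = F j := by
      intro i j hij
      rw [← hper.map_mod_nat i, ← hper.map_mod_nat j, (hf.eq_iff i j).1 hij]
    set x : V → ℂ := fun w => if h : ∃ i, f i = w then F h.choose else 0 with hx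
    have hxf : ∀ i, x (f i) = F i := by
      intro i
      have h : ∃ j, f j = f i := ⟨i, rfl⟩
      simp only [hx]
      rw [dif_pos h]
      exact hFeq _ _ h.choose_spec
    -- The equations are stated at successor indices; a shift by a full period reaches index 0.
    have hsucc : ∀ i, ∃ j, f i = f (j + 1) := fun i =>
      ⟨i + (l - 1), by rw [show i + (l - 1) + 1 = i + l by have := hf.pos; omega, hf.periodic]⟩
    refine ⟨x, ?_, ?_⟩
    · ext a
      by_cases ha : ∃ i, f i = a
      · obtain ⟨i, rfl⟩ := ha
        obtain ⟨j, hj⟩ := hsucc i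
        rw [hj, hf.mask_mulVec, hxf, hxf, hW.symm_apply (f j) (f (j + 1))]
        have h1 := hW.conj_mul (f (j + 1)) (f (j + 1 + 1))
        simp only [hF, seqProd_succ, map_mul, hy2, Pi.zero_apply]
        linear_combination (-conj (seqProd W f j) * conj (W (f j) (f (j + 1))) * y j) * h1
      · rw [SimpleGraph.mask_mulVec]
        refine Finset.sum_eq_zero fun b _ => ?_
        split_ifs with hab
        · by_cases hb : ∃ i, f i = b
          · obtain ⟨i, rfl⟩ := hb
            obtain ⟨j, hj⟩ := hsucc i
            rw [hj] at hab
            rcases (hf.adj_iff j a).1 hab.symm with h | h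
            · exact (ha ⟨_, h.symm⟩).elim
            · exact (ha ⟨_, h.symm⟩).elim
          · simp [hx, hb]
        · rfl
    · rw [hxf]
      simpa [hF, seqProd] using hy0

end IsCyclicSequence

/-- A cycle which is a connected component of `H` yields a cyclic sequence. -/
lemma Walk.IsCycle.isCyclicSequence {G : SimpleGraph V} {v : V} {p : G.Walk v v} (hp : p.IsCycle)
    (hH : ∀ w ∈ p.support, ∀ b, H.Adj w b ↔ s(w, b) ∈ p.edges) :
    H.IsCyclicSequence p.length (fun i => p.getVert (i % p.length)) := by
  have hl := hp.three_le_length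
  have heq : ∀ i j, p.getVert (i % p.length) = p.getVert (j % p.length) ↔
      i ≡ j [MOD p.length] := by
    intro i j
    refine ⟨fun h => ?_, fun h => by rw [h]⟩
    have hi := Nat.mod_lt i (by omega : 0 < p.length)
    have hj := Nat.mod_lt j (by omega : 0 < p.length)
    exact hp.getVert_injOn' (by simp only [Set.mem_ofPred_eq]; omega)
      (by simp only [Set.mem_ofPred_eq]; omega) h
  -- Past the end `getVert` stays constant, so indices are reduced modulo the length; at the last
  -- edge this uses that the walk is closed.
  have hsucc : ∀ j < p.length, p.getVert (j + 1) = p.getVert ((j + 1) % p.length) := by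
    intro j hj
    rcases Nat.lt_or_ge (j + 1) p.length with h | h
    · rw [Nat.mod_eq_of_lt h]
    · rw [show j + 1 = p.length by omega, Nat.mod_self, p.getVert_length, p.getVert_zero]
  refine ⟨by omega, heq, fun i h => ?_, fun i b => ?_⟩
  · rw [heq] at h
    have h2 := (Nat.modEq_iff_dvd' (by omega)).1 h
    have := Nat.le_of_dvd (by omega) h2
    omega
  · rw [hH _ (p.getVert_mem_support _), ← p.adj_toSubgraph_iff_mem_edges, p.toSubgraph_adj_iff]
    constructor
    · rintro ⟨j, hj, hjl⟩
      have hj' : p.getVert j = p.getVert (j % p.length) := by rw [Nat.mod_eq_of_lt hjl]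
      rw [hsucc j hjl, hj'] at hj
      rcases Sym2.eq_iff.1 hj with ⟨h1, rfl⟩ | ⟨rfl, h1⟩
      · right
        rw [heq] at h1 ⊢
        exact h1.add_right 1
      · left
        rw [heq] at h1 ⊢
        exact Nat.ModEq.add_right_cancel' 1 h1
    · have hmod : ∀ k : ℕ, p.getVert (k % p.length + 1) = p.getVert ((k + 1) % p.length) := by
        intro k
        rw [hsucc _ (Nat.mod_lt _ (by omega)), heq]
        exact (Nat.mod_modEq k _).add_right 1
      rintro (rfl | rfl)
      · refine ⟨i % p.length, ?_, Nat.mod_lt _ (by omega)⟩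
        rw [hmod, Sym2.eq_swap]
      · refine ⟨(i + 1) % p.length, ?_, Nat.mod_lt _ (by omega)⟩
        rw [hmod]

/-- The product of the entries of `W` along a walk. -/
noncomputable def walkProd (W : Matrix V V ℂ) {G : SimpleGraph V} {u v : V} (p : G.Walk u v) : ℂ :=
  ∏ j ∈ Finset.range p.length, W (p.getVert j) (p.getVert (j + 1))

lemma exists_null_iff_singularGain [Fintype V] [DecidableEq V] (hW : IsUnitHermitian W)
    {G : SimpleGraph V} {v : V} {p : G.Walk v v} (hp : p.IsCycle)
    (hH : ∀ w ∈ p.support, ∀ b, H.Adj w b ↔ s(w, b) ∈ p.edges) :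
    (∃ x, mask W H *ᵥ x = 0 ∧ x v ≠ 0) ↔ SingularGain p.length (walkProd W p) := by
  have hl := hp.three_le_length
  have := (hp.isCyclicSequence hH).exists_null_iff hW
  simp only [Nat.zero_mod, p.getVert_zero] at this
  rw [this]
  suffices h : seqProd W (fun i => p.getVert (i % p.length)) p.length = walkProd W p by rw [h]
  unfold seqProd walkProd
  refine Finset.prod_congr rfl fun j hj => ?_
  rw [Finset.mem_range] at hj
  have h1 : j % p.length = j := Nat.mod_eq_of_lt hj
  have h2 : p.getVert ((j + 1) % p.length) = p.getVert (j + 1) := by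
    rcases Nat.lt_or_ge (j + 1) p.length with h | h
    · rw [Nat.mod_eq_of_lt h]
    · rw [show j + 1 = p.length by omega, Nat.mod_self, p.getVert_length, p.getVert_zero]
  change W (p.getVert (j % p.length)) (p.getVert ((j + 1) % p.length)) = _
  rw [h1, h2]

end SimpleGraph

namespace SimpleGraph

/-! ### Sufficiency of the conditions -/

section Sufficiency

variable {V : Type*} [Fintype V] [DecidableEq V] {W : Matrix V V ℂ}

lemma walkProd_mapLe {H' H : SimpleGraph V} (h : H' ≤ H) {u v : V} (p : H'.Walk u v) :
    walkProd W (p.mapLe h) = walkProd W p := by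
  simp [walkProd, Walk.mapLe, Walk.getVert_map]

lemma rank_mask_le_isolate (hW : IsUnitHermitian W) (H : SimpleGraph V) (X : Finset V) :
    (mask W H).rank ≤ (mask W (H.isolate X)).rank + 2 * X.card := by
  induction X using Finset.induction_on generalizing H with
  | empty =>
    have : H.isolate ((∅ : Finset V) : Set V) = H := by ext a b; simp [isolate_adj]
    rw [this]; simp
  | insert v X hv ih =>
    have h1 := ih (H.isolate {v})
    have h2 := rank_le_coordCut_add_two (v := v) (mask_isHermitian hW H)
    rw [← mask_isolate] at h2
    rw [isolate_isolate] at h1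
    rw [Finset.card_insert_of_notMem hv, Finset.coe_insert, Set.insert_eq]
    omega

/-- If every cycle of `H` is a connected component with singular gain, the defect vanishes. -/
lemma defect_eq_zero_of_isolated_cycles (hW : IsUnitHermitian W) {H : SimpleGraph V}
    (hH : ∀ (v : V) (p : H.Walk v v), p.IsCycle →
      (∀ w ∈ p.support, ∀ b, H.Adj w b → s(w, b) ∈ p.edges) ∧
        SingularGain p.length (walkProd W p)) : defect W H = 0 := by
  induction H using WellFoundedLT.induction with
  | _ H ih =>
    by_cases hc : ∃ v, H.IsCyclic v
    · obtain ⟨v₀, p₀, hp₀⟩ := hc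
      obtain ⟨S, hS, hcard⟩ := H.exists_isIndepSet_card_eq
      -- Two consecutive vertices of a cycle are not both in `S`. Isolating a cyclic vertex outside
      -- `S` makes α grow.
      obtain ⟨v, hvS, p, hp⟩ : ∃ v ∉ S, H.IsCyclic v := by
        by_cases h : v₀ ∈ S
        · refine ⟨p₀.snd, fun h' => hS _ h _ h' (p₀.adj_snd hp₀.not_nil), ?_⟩
          exact .of_mem_support hp₀ (p₀.getVert_mem_support 1)
        · exact ⟨v₀, h, p₀, hp₀⟩
      have hadj := p.adj_snd hp.not_nil
      have h0 : defect W (H.isolate {v}) = 0 := by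
        refine ih _ (isolate_lt hadj (Set.mem_singleton v)) fun w q hq => ?_
        obtain ⟨h1, h2⟩ := hH w (q.mapLe (isolate_le _ _)) (hq.mapLe _)
        refine ⟨fun a ha b hab => ?_, ?_⟩
        · simpa using h1 a (by simpa using ha) b hab.1
        · rwa [walkProd_mapLe, Walk.mapLe, Walk.length_map] at h2
      obtain ⟨h1, h2⟩ := hH v p hp
      obtain ⟨x, hx, hxv⟩ := (exists_null_iff_singularGain hW hp fun w hw b =>
        ⟨h1 w hw b, p.adj_of_mem_edges⟩).2 h2
      have hr := rank_le_coordCut_of_null (mask_isHermitian hW H) hx hxv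
      rw [← mask_isolate] at hr
      have hα : H.indepNum + 1 ≤ (H.isolate {v}).indepNum := by
        rw [← hcard, ← Finset.card_insert_of_notMem hvS]
        refine card_le_indepNum fun a ha b hb hab => ?_
        exact hS a (Finset.mem_of_mem_insert_of_ne ha hab.2.1) b
          (Finset.mem_of_mem_insert_of_ne hb hab.2.2) hab.1
      -- Deleting one cycle edge at v kills every cycle through v, because such cycles use all edges
      -- at v; the remaining cycles survive isolation.
      have hcyc : H.cyclomaticNumber ≤ (H.isolate {v}).cyclomaticNumber + 1 := by
        refine (cyclomaticNumber_le_deleteEdges_add_one H s(v, p.snd)).trans ?_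
        gcongr
        refine cyclomaticNumber_le_of_cycles
          (le_deleteEdges_of_not_adj (isolate_le _ _) (by simp [isolate_adj]))
          fun w q hq e he => ?_
        have hvq : v ∉ q.support := by
          intro hvq
          have := (hH w (q.mapLe (deleteEdges_le _)) (hq.mapLe _)).1 v (by simpa using hvq) _ hadj
          have h3 := q.edges_subset_edgeSet (by simpa using this)
          rw [edgeSet_deleteEdges] at h3
          exact h3.2 rfl
        induction e with
        | _ a b =>
          have h3 := q.edges_subset_edgeSet he
          rw [edgeSet_deleteEdges] at h3
          refine ⟨h3.1, fun h => hvq ?_, fun h => hvq ?_⟩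
          · exact Set.mem_singleton_iff.1 h ▸ q.fst_mem_support_of_mem_edges he
          · exact Set.mem_singleton_iff.1 h ▸ q.snd_mem_support_of_mem_edges he
      have h3 := defect_nonneg hW H
      unfold defect at *
      omega
    · push Not at hc
      exact defect_eq_zero_of_forall_not_isCyclic hW hc

/-- Isolating `F \ S`, the non-cyclic vertices outside `S`, costs at most 2 in rank per vertex,
keeps c, and raises α by at least its cardinality since `S` is maximum in `F`; so the defect of `G`
is at most that of the cycles alone. -/
lemma defect_eq_zero_of_indepSet (hW : IsUnitHermitian W) {G : SimpleGraph V}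
    (hdis : G.DisjointCycles)
    (hgain : ∀ (v : V) (p : G.Walk v v), p.IsCycle → SingularGain p.length (walkProd W p))
    (hadj : ∀ a b, G.Adj a b → G.IsCyclic a → G.IsCyclic b →
      ∃ (v : V) (p : G.Walk v v), p.IsCycle ∧ a ∈ p.support ∧ b ∈ p.support)
    {S : Finset V} (hSc : ∀ a ∈ S, ¬ G.IsCyclic a) (hS : ∀ a ∈ S, ∀ b ∈ S, ¬ G.Adj a b)
    (hSN : ∀ a ∈ S, ∀ b, G.Adj a b → ¬ G.IsCyclic b)
    (hmax : ∀ I : Finset V, (∀ a ∈ I, ¬ G.IsCyclic a) → (∀ a ∈ I, ∀ b ∈ I, ¬ G.Adj a b) →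
        I.card ≤ S.card) : defect W G = 0 := by
  classical
  set F : Finset V := Finset.univ.filter fun a => ¬ G.IsCyclic a
  have hF : ∀ {a}, a ∈ F ↔ ¬ G.IsCyclic a := by simp [F]
  set K := G.isolate F
  have hK : ∀ {a b}, K.Adj a b ↔ G.Adj a b ∧ G.IsCyclic a ∧ G.IsCyclic b := by
    intro a b; simp [K, isolate_adj, F]
  have hKG : K ≤ G := isolate_le _ _
  -- All neighbours of `S` lie in `F \ S`, so the vertices of `S` become isolated automatically.
  have hKF : G.isolate ((F \ S : Finset V) : Set V) = K := by
    ext a b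
    simp only [isolate_adj, hK, Finset.mem_coe, Finset.mem_sdiff, hF, not_and, not_not]
    refine ⟨fun ⟨h, ha, hb⟩ => ⟨h, ?_⟩, fun ⟨h, ha, hb⟩ => ⟨h, fun h' => (h' ha).elim,
      fun h' => (h' hb).elim⟩⟩
    by_cases haS : a ∈ S
    · have hbc := hSN a haS b h
      exact (hS a haS b (hb hbc) h).elim
    · have hac : G.IsCyclic a := not_not.1 fun h' => haS (ha h')
      refine ⟨hac, not_not.1 fun hbc => ?_⟩
      exact hSN b (hb hbc) a h.symm hac
  have hdK : defect W K = 0 := by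
    refine defect_eq_zero_of_isolated_cycles hW fun v p hp => ⟨fun w hw b hwb => ?_, ?_⟩
    · obtain ⟨hwb, hwc, hbc⟩ := hK.1 hwb
      obtain ⟨t, q, hq, hwq, hbq⟩ := hadj w b hwb hwc hbc
      have hp' := hp.mapLe hKG
      have hw' : w ∈ (p.mapLe hKG).support := by simpa using hw
      by_contra he
      obtain ⟨Q, hs⟩ := exists_isBridgeSide_of_not_mem_edges hdis hp' hw' hwb (by simpa using he)
      exact hs.notMem_support hq hbq hwq
    · have := hgain v _ (hp.mapLe hKG)
      rwa [walkProd_mapLe, Walk.mapLe, Walk.length_map] at this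
  have hr := rank_mask_le_isolate hW G (F \ S)
  rw [hKF] at hr
  have hc : G.cyclomaticNumber ≤ K.cyclomaticNumber := by
    refine cyclomaticNumber_le_of_cycles hKG fun v p hp e he => ?_
    induction e with
    | _ a b =>
      exact hK.2 ⟨p.adj_of_mem_edges he, .of_mem_support hp (p.fst_mem_support_of_mem_edges he),
        .of_mem_support hp (p.snd_mem_support_of_mem_edges he)⟩
  obtain ⟨M, hM, hMc⟩ := G.exists_isIndepSet_card_eq
  have hα : ((M \ F) ∪ F).card ≤ K.indepNum := by
    refine card_le_indepNum fun a ha b hb hab => ?_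
    obtain ⟨hab, ha', hb'⟩ := hK.1 hab
    simp only [Finset.mem_union, Finset.mem_sdiff, hF] at ha hb
    exact hM a (by tauto) b (by tauto) hab
  rw [Finset.card_union_of_disjoint Finset.sdiff_disjoint] at hα
  have h1 := hmax (M ∩ F) (fun a ha => hF.1 (Finset.mem_inter.1 ha).2) fun a ha b hb =>
    hM a (Finset.mem_inter.1 ha).1 b (Finset.mem_inter.1 hb).1
  have h2 := Finset.card_sdiff_add_card_inter M F
  have h3 := Finset.card_sdiff_add_card_eq_card (s := S) (t := F) fun a ha => hF.2 (hSc a ha)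
  have h4 := defect_nonneg hW G
  unfold defect at *
  omega

end Sufficiency

/-! ### The contraction of the cycles -/

section Contraction

variable {V : Type*} {G : SimpleGraph V}

lemma mem_cycleSubgraphs_toSubgraph {v : V} {p : G.Walk v v} (hp : p.IsCycle) :
    p.toSubgraph ∈ G.cycleSubgraphs := ⟨v, p, hp, rfl⟩

lemma pairwise_disjoint_iff_disjointCycles :
    (G.cycleSubgraphs.Pairwise fun C D => Disjoint C.verts D.verts) ↔ G.DisjointCycles := by
  constructor
  · intro h u w v p q hp hq hvp hvq e he
    by_cases heq : p.toSubgraph = q.toSubgraph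
    · rw [← Walk.mem_edges_toSubgraph, ← heq, Walk.mem_edges_toSubgraph]
      exact he
    · have := h (mem_cycleSubgraphs_toSubgraph hp) (mem_cycleSubgraphs_toSubgraph hq) heq
      exact (Set.disjoint_left.1 this (p.mem_verts_toSubgraph.2 hvp)
        (q.mem_verts_toSubgraph.2 hvq)).elim
  · rintro h _ ⟨u, p, hp, rfl⟩ _ ⟨w, q, hq, rfl⟩ hne
    rw [Set.disjoint_left]
    intro v hvp hvq
    rw [Walk.mem_verts_toSubgraph] at hvp hvq
    refine hne (Subgraph.ext ?_ ?_)
    · ext x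
      rw [Walk.mem_verts_toSubgraph, Walk.mem_verts_toSubgraph]
      exact ⟨h.support_subset hp hq hvp hvq x, h.support_subset hq hp hvq hvp x⟩
    · ext a b
      rw [Walk.adj_toSubgraph_iff_mem_edges, Walk.adj_toSubgraph_iff_mem_edges]
      exact ⟨h hp hq hvp hvq _, h hq hp hvq hvp _⟩

/-- Two vertices lie on a common cycle. -/
def SameCycle (G : SimpleGraph V) (a b : V) : Prop :=
  ∃ (v : V) (p : G.Walk v v), p.IsCycle ∧ a ∈ p.support ∧ b ∈ p.support

lemma SameCycle.isCyclic_left {a b : V} (h : G.SameCycle a b) : G.IsCyclic a :=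
  let ⟨_, _, hp, ha, _⟩ := h
  .of_mem_support hp ha

lemma SameCycle.symm {a b : V} (h : G.SameCycle a b) : G.SameCycle b a :=
  let ⟨v, p, hp, ha, hb⟩ := h
  ⟨v, p, hp, hb, ha⟩

lemma DisjointCycles.sameCycle_trans (hd : G.DisjointCycles) {a b c : V} (hab : G.SameCycle a b)
    (hbc : G.SameCycle b c) : G.SameCycle a c := by
  obtain ⟨v, p, hp, ha, hb⟩ := hab
  obtain ⟨w, q, hq, hb', hc⟩ := hbc
  exact ⟨v, p, hp, ha, hd.support_subset hq hp hb' hb c hc⟩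

/-- The vertex of the contraction onto which a vertex is mapped. -/
def contract (G : SimpleGraph V) (a : V) : Quotient G.cycleSetoid := Quotient.mk G.cycleSetoid a

/-- Disjointness makes lying on a common cycle transitive, so the generated equivalence relation
needs no chains. -/
lemma DisjointCycles.contract_eq_iff (hd : G.DisjointCycles) {a b : V} :
    G.contract a = G.contract b ↔ a = b ∨ G.SameCycle a b := by
  have hgen : ∀ {a b : V}, (∃ C ∈ G.cycleSubgraphs, a ∈ C.verts ∧ b ∈ C.verts) ↔
      G.SameCycle a b := by
    intro a b
    constructor
    · rintro ⟨_, ⟨v, p, hp, rfl⟩, ha, hb⟩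
      exact ⟨v, p, hp, p.mem_verts_toSubgraph.1 ha, p.mem_verts_toSubgraph.1 hb⟩
    · rintro ⟨v, p, hp, ha, hb⟩
      exact ⟨_, ⟨v, p, hp, rfl⟩, p.mem_verts_toSubgraph.2 ha, p.mem_verts_toSubgraph.2 hb⟩
  constructor
  · intro h
    have h' : Relation.EqvGen (fun u v => ∃ C ∈ G.cycleSubgraphs, u ∈ C.verts ∧ v ∈ C.verts) a b :=
      Quotient.exact h
    induction h' with
    | rel a b hab => exact Or.inr (hgen.1 hab)
    | refl a => exact Or.inl rfl
    | symm a b hab ih =>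
      rcases ih h.symm with rfl | h1
      · exact Or.inl rfl
      · exact Or.inr h1.symm
    | trans a b c hab hbc ih1 ih2 =>
      rcases ih1 (Quotient.sound hab) with rfl | h1
      · exact ih2 h
      · rcases ih2 (Quotient.sound hbc) with rfl | h2
        · exact Or.inr h1
        · exact Or.inr (hd.sameCycle_trans h1 h2)
  · rintro (rfl | h)
    · rfl
    · exact Quotient.sound (Relation.EqvGen.rel _ _ (hgen.2 h))

lemma DisjointCycles.contract_eq_iff_of_not (hd : G.DisjointCycles) {a b : V}
    (ha : ¬ G.IsCyclic a) : G.contract a = G.contract b ↔ a = b := by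
  rw [hd.contract_eq_iff]
  exact ⟨fun h => h.resolve_right fun h => ha h.isCyclic_left, Or.inl⟩

lemma DisjointCycles.contract_mem_cyclicVertices (hd : G.DisjointCycles) {a : V} :
    G.contract a ∈ G.cyclicVertices ↔ G.IsCyclic a := by
  constructor
  · rintro ⟨_, ⟨w, p, hp, rfl⟩, v, hv, h⟩
    have hv' := p.mem_verts_toSubgraph.1 hv
    rcases hd.contract_eq_iff.1 h with rfl | h
    · exact .of_mem_support hp hv'
    · exact h.isCyclic_left
  · rintro ⟨p, hp⟩
    exact ⟨_, mem_cycleSubgraphs_toSubgraph hp, a, p.mem_verts_toSubgraph.2 p.start_mem_support, rfl⟩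

lemma cycleContraction_adj {x y : Quotient G.cycleSetoid} : G.cycleContraction.Adj x y ↔
    x ≠ y ∧ ∃ a b, G.Adj a b ∧ G.contract a = x ∧ G.contract b = y := Iff.rfl

variable [Finite V]

instance : Finite (Quotient G.cycleSetoid) := Quotient.finite _

/-- Chosen representatives of the cyclic classes form a transversal of the cycles. -/
lemma DisjointCycles.cyclomaticNumber_eq_ncard (hd : G.DisjointCycles) :
    G.cyclomaticNumber = (G.cyclicVertices.ncard : ℤ) := by
  classical
  have hout : ∀ x : Quotient G.cycleSetoid, G.contract x.out = x := fun x => Quotient.out_eq x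
  have hfin : G.cyclicVertices.Finite := Set.toFinite _
  rw [hd.cyclomaticNumber_eq_card (X := hfin.toFinset.image Quotient.out),
    Finset.card_image_of_injective _ Quotient.out_injective, Set.ncard_eq_toFinset_card _ hfin]
  · intro a ha
    obtain ⟨x, hx, rfl⟩ := Finset.mem_image.1 ha
    rw [← hd.contract_mem_cyclicVertices, hout]
    simpa using hx
  · intro u p hp
    refine ⟨(G.contract u).out, Finset.mem_image.2 ⟨_, ?_, rfl⟩, ?_⟩
    · rw [Set.Finite.mem_toFinset, hd.contract_mem_cyclicVertices]
      exact ⟨p, hp⟩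
    · rcases hd.contract_eq_iff.1 (hout (G.contract u)) with h | ⟨v, q, hq, h1, h2⟩
      · rw [h]; exact p.start_mem_support
      · exact hd.support_subset hq hp h2 p.start_mem_support _ h1
  · intro u p hp a ha b hb hap hbp
    obtain ⟨x, -, rfl⟩ := Finset.mem_image.1 ha
    obtain ⟨y, -, rfl⟩ := Finset.mem_image.1 hb
    have := hd.contract_eq_iff.2 (Or.inr ⟨u, p, hp, hap, hbp⟩)
    rw [hout, hout] at this
    rw [this]

/-- Independent sets of non-cyclic vertices are independent sets of `[T_G]`. -/
lemma DisjointCycles.card_le_indepNum_reduced (hd : G.DisjointCycles) {I : Finset V}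
    (hI : ∀ a ∈ I, ¬ G.IsCyclic a) (hI' : ∀ a ∈ I, ∀ b ∈ I, ¬ G.Adj a b) :
    I.card ≤ G.reducedCycleContraction.indepNum := by
  classical
  let f : {a // a ∈ I} → ↥(G.cyclicVerticesᶜ) := fun a =>
    ⟨G.contract a, fun h => hI a a.2 (hd.contract_mem_cyclicVertices.1 h)⟩
  have hf : Function.Injective f := fun a b h =>
    Subtype.ext ((hd.contract_eq_iff_of_not (hI a a.2)).1 (congrArg Subtype.val h))
  rw [← Finset.card_attach, ← Finset.card_image_of_injective _ hf]
  refine card_le_indepNum fun x hx y hy hxy => ?_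
  obtain ⟨a, -, rfl⟩ := Finset.mem_image.1 hx
  obtain ⟨b, -, rfl⟩ := Finset.mem_image.1 hy
  obtain ⟨-, c, d, hcd, hc, hd'⟩ := hxy
  have h1 := (hd.contract_eq_iff_of_not (hI a a.2)).1 hc.symm
  have h2 := (hd.contract_eq_iff_of_not (hI b b.2)).1 hd'.symm
  exact hI' a a.2 b b.2 (h1 ▸ h2 ▸ hcd)

/-- The non-cyclic part of an independent set of `T_G` has at most `α([T_G])` elements. -/
lemma card_filter_le_indepNum_reduced {M : Finset (Quotient G.cycleSetoid)}
    (hM : ∀ x ∈ M, ∀ y ∈ M, ¬ G.cycleContraction.Adj x y)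
    [DecidablePred (· ∈ G.cyclicVerticesᶜ)] :
    (M.filter (· ∈ G.cyclicVerticesᶜ)).card ≤ G.reducedCycleContraction.indepNum := by
  rw [← Finset.card_subtype]
  refine card_le_indepNum fun x hx y hy hxy => ?_
  exact hM x (Finset.mem_subtype.1 hx) y (Finset.mem_subtype.1 hy) hxy

/-- A non-cyclic part of an independent set of `T_G` is realized in `G`. -/
lemma DisjointCycles.exists_indepSet_of_contraction (hd : G.DisjointCycles)
    {M : Finset (Quotient G.cycleSetoid)}
    (hM : ∀ x ∈ M, ∀ y ∈ M, ¬ G.cycleContraction.Adj x y) :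
    ∃ S : Finset V, (∀ a, a ∈ S ↔ ¬ G.IsCyclic a ∧ G.contract a ∈ M) ∧
      (∀ a ∈ S, ∀ b ∈ S, ¬ G.Adj a b) ∧ M.card ≤ S.card + G.cyclicVertices.ncard := by
  classical
  have : Fintype V := Fintype.ofFinite V
  have hS : ∀ a, a ∈ Finset.univ.filter (fun a => ¬ G.IsCyclic a ∧ G.contract a ∈ M) ↔
    ¬ G.IsCyclic a ∧ G.contract a ∈ M := fun a => by simp
  refine ⟨_, hS, fun a ha b hb hab => ?_, ?_⟩
  · rw [hS] at ha hb
    refine hM _ ha.2 _ hb.2 (cycleContraction_adj.2 ⟨fun h => hab.ne ?_, a, b, hab, rfl, rfl⟩)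
    exact (hd.contract_eq_iff_of_not ha.1).1 h
  · have hfin : G.cyclicVertices.Finite := Set.toFinite _
    rw [Set.ncard_eq_toFinset_card _ hfin]
    refine le_trans (Finset.card_le_card (t := (Finset.univ.filter
      (fun a => ¬ G.IsCyclic a ∧ G.contract a ∈ M)).image G.contract ∪ hfin.toFinset) ?_) ?_
    · intro x hx
      rw [Finset.mem_union, Set.Finite.mem_toFinset]
      by_cases hxc : x ∈ G.cyclicVertices
      · exact Or.inr hxc
      · left
        obtain ⟨a, rfl⟩ : ∃ a, G.contract a = x := Quotient.exists_rep x
        rw [hd.contract_mem_cyclicVertices] at hxc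
        exact Finset.mem_image_of_mem _ ((hS a).2 ⟨hxc, hx⟩)
    · refine (Finset.card_union_le _ _).trans ?_
      gcongr
      exact Finset.card_image_le

/-- The condition on the independence numbers of `T_G` and `[T_G]`, in terms of `G`. -/
lemma DisjointCycles.indepNum_contraction_iff (hd : G.DisjointCycles) :
    (G.cycleContraction.indepNum : ℤ) =
        (G.reducedCycleContraction.indepNum : ℤ) + G.cyclomaticNumber ↔
      (∀ a b, G.Adj a b → G.IsCyclic a → G.IsCyclic b → G.SameCycle a b) ∧
      ∃ S : Finset V, (∀ a ∈ S, ¬ G.IsCyclic a) ∧ (∀ a ∈ S, ∀ b ∈ S, ¬ G.Adj a b) ∧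
        (∀ a ∈ S, ∀ b, G.Adj a b → ¬ G.IsCyclic b) ∧
        ∀ I : Finset V, (∀ a ∈ I, ¬ G.IsCyclic a) → (∀ a ∈ I, ∀ b ∈ I, ¬ G.Adj a b) →
          I.card ≤ S.card := by
  classical
  rw [hd.cyclomaticNumber_eq_ncard]
  have hfin : G.cyclicVertices.Finite := Set.toFinite _
  have hncard := Set.ncard_eq_toFinset_card _ hfin
  constructor
  · intro h
    obtain ⟨M, hM, hMc⟩ := G.cycleContraction.exists_isIndepSet_card_eq
    obtain ⟨S, hS, hSi, hSc⟩ := hd.exists_indepSet_of_contraction hM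
    have hSr := hd.card_le_indepNum_reduced (fun a ha => ((hS a).1 ha).1) hSi
    have h1 := card_filter_le_indepNum_reduced hM
    have h2 := Finset.card_filter_add_card_filter_not (s := M) (· ∈ G.cyclicVerticesᶜ)
    have hsub : M.filter (fun x => ¬ x ∈ G.cyclicVerticesᶜ) ⊆ hfin.toFinset := by
      intro x hx
      have := (Finset.mem_filter.1 hx).2
      simpa using this
    -- The non-cyclic part of `M` has at most α([T_G]) elements, so equality forces `M` to contain
    -- every cyclic vertex of T_G.
    have heq := Finset.eq_of_subset_of_card_le hsub (by omega)
    have hcM : ∀ a, G.IsCyclic a → G.contract a ∈ M := by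
      intro a ha
      have : G.contract a ∈ hfin.toFinset := by
        rw [Set.Finite.mem_toFinset, hd.contract_mem_cyclicVertices]; exact ha
      rw [← heq] at this
      exact (Finset.mem_filter.1 this).1
    refine ⟨fun a b hab ha hb => ?_, S, fun a ha => ((hS a).1 ha).1, hSi, fun a ha b hab hb => ?_,
      fun I hI hI' => ?_⟩
    · by_contra hn
      refine hM _ (hcM a ha) _ (hcM b hb)
        (cycleContraction_adj.2 ⟨fun h => hn ?_, a, b, hab, rfl, rfl⟩)
      exact (hd.contract_eq_iff.1 h).resolve_left hab.ne
    · refine hM _ ((hS a).1 ha).2 _ (hcM b hb)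
        (cycleContraction_adj.2 ⟨fun h => hab.ne ?_, a, b, hab, rfl, rfl⟩)
      exact (hd.contract_eq_iff_of_not ((hS a).1 ha).1).1 h
    · have := hd.card_le_indepNum_reduced hI hI'
      omega
  · rintro ⟨hcc, S, hSc, hSi, hSN, hmax⟩
    have h1 : G.cycleContraction.indepNum ≤
        G.reducedCycleContraction.indepNum + G.cyclicVertices.ncard := by
      obtain ⟨M, hM, hMc⟩ := G.cycleContraction.exists_isIndepSet_card_eq
      obtain ⟨S, hS, hSi, hSc⟩ := hd.exists_indepSet_of_contraction hM
      have hSr := hd.card_le_indepNum_reduced (fun a ha => ((hS a).1 ha).1) hSi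
      omega
    have h2 : G.reducedCycleContraction.indepNum ≤ S.card := by
      obtain ⟨J, hJ, hJc⟩ := G.reducedCycleContraction.exists_isIndepSet_card_eq
      have : Fintype V := Fintype.ofFinite V
      have hI : ∀ a, a ∈ Finset.univ.filter (fun a => ∃ x ∈ J, x.1 = G.contract a) ↔
        ∃ x ∈ J, x.1 = G.contract a := fun a => by simp
      have hIc : ∀ a ∈ Finset.univ.filter (fun a => ∃ x ∈ J, x.1 = G.contract a),
          ¬ G.IsCyclic a := by
        intro a ha hac
        obtain ⟨x, -, hx⟩ := (hI a).1 ha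
        exact x.2 (hx ▸ hd.contract_mem_cyclicVertices.2 hac)
      have h3 := hmax _ hIc fun a ha b hb hab => by
        have hac := hIc a ha
        obtain ⟨x, hxJ, hx⟩ := (hI a).1 ha
        obtain ⟨y, hyJ, hy⟩ := (hI b).1 hb
        refine hJ x hxJ y hyJ (cycleContraction_adj.2
          ⟨fun h => hab.ne ?_, a, b, hab, hx.symm, hy.symm⟩)
        exact (hd.contract_eq_iff_of_not hac).1 (hx.symm.trans (h.trans hy))
      have h4 : J.card ≤ (Finset.univ.filter (fun a => ∃ x ∈ J, x.1 = G.contract a)).card := by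
        rw [← Finset.card_map (Function.Embedding.subtype _)]
        refine le_trans (Finset.card_le_card ?_) (Finset.card_image_le (f := G.contract))
        intro x hx
        obtain ⟨y, hy, rfl⟩ := Finset.mem_map.1 hx
        obtain ⟨a, ha⟩ : ∃ a, G.contract a = y.1 := Quotient.exists_rep y.1
        exact Finset.mem_image.2 ⟨a, (hI a).2 ⟨y, hy, ha.symm⟩, ha⟩
      omega
    -- All contracted cycles together with the image of `S` form an independent set of T_G, which
    -- attains the upper bound.
    have h3 : (hfin.toFinset ∪ S.image G.contract).card ≤ G.cycleContraction.indepNum := by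
      have hmem : ∀ a, G.contract a ∈ hfin.toFinset ∪ S.image G.contract →
          G.IsCyclic a ∨ a ∈ S := by
        intro a ha
        rcases Finset.mem_union.1 ha with ha | ha
        · rw [Set.Finite.mem_toFinset, hd.contract_mem_cyclicVertices] at ha
          exact Or.inl ha
        · obtain ⟨b, hb, hba⟩ := Finset.mem_image.1 ha
          exact Or.inr ((hd.contract_eq_iff_of_not (hSc b hb)).1 hba ▸ hb)
      refine card_le_indepNum fun x hx y hy hxy => ?_
      obtain ⟨hne, a, b, hab, rfl, rfl⟩ := cycleContraction_adj.1 hxy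
      rcases hmem a hx with ha | ha <;> rcases hmem b hy with hb | hb
      · exact hne (hd.contract_eq_iff.2 (Or.inr (hcc a b hab ha hb)))
      · exact hSN b hb a hab.symm ha
      · exact hSN a ha b hab hb
      · exact hSi a ha b hb hab
    rw [Finset.card_union_of_disjoint, Finset.card_image_of_injOn, ← hncard] at h3
    · omega
    · intro a ha b _ hab
      exact (hd.contract_eq_iff_of_not (hSc a ha)).1 hab
    · rw [Finset.disjoint_left]
      intro x hx hx'
      obtain ⟨a, ha, rfl⟩ := Finset.mem_image.1 hx'
      rw [Set.Finite.mem_toFinset, hd.contract_mem_cyclicVertices] at hx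
      exact hSc a ha hx

end Contraction

/-! ### The characterization of defect zero -/

/-- The equality case of the rank bound. -/
theorem defect_eq_zero_iff {V : Type*} [Fintype V] [DecidableEq V] {W : Matrix V V ℂ}
    (hW : IsUnitHermitian W) (G : SimpleGraph V) : defect W G = 0 ↔ G.DisjointCycles ∧
      (∀ (v : V) (p : G.Walk v v), p.IsCycle → SingularGain p.length (walkProd W p)) ∧
      (G.cycleContraction.indepNum : ℤ) =
        (G.reducedCycleContraction.indepNum : ℤ) + G.cyclomaticNumber := by
  constructor
  · intro hd
    have hdis := disjointCycles_of_defect_eq_zero hW hd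
    have hcc : ∀ {v : V} {p : G.Walk v v}, p.IsCycle → ∀ a ∈ p.support, ∀ b, G.Adj a b →
        G.IsCyclic b → s(a, b) ∈ p.edges := by
      intro v p hp a ha b hab hb
      by_contra he
      obtain ⟨Q, hs⟩ := exists_isBridgeSide_of_not_mem_edges hdis hp ha hab he
      exact hs.not_isCyclic hW hd (.of_mem_support hp ha) hb
    refine ⟨hdis, fun v p hp => ?_, hdis.indepNum_contraction_iff.2 ⟨fun a b hab ha hb => ?_,
      exists_indepSet_of_defect_eq_zero hW hd⟩⟩
    -- In `H₀` every cycle of `G` is a component: edges to non-cyclic vertices are gone, and other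
    -- edges to cyclic vertices are excluded by `hcc`.
    · obtain ⟨H₀, hle, hd0, -, hcyc, hsep⟩ := exists_le_separated hW hd
      rw [← exists_null_iff_singularGain (H := H₀) hW hp]
      · exact exists_null_of_isCyclic hW hd0 ⟨_, hp.transfer (hcyc v p hp)⟩
      · intro w hw b
        refine ⟨fun h => ?_, hcyc v p hp _⟩
        exact hcc hp w hw b (hle h) (hsep w b h (.of_mem_support hp hw))
    · obtain ⟨p, hp⟩ := ha
      exact ⟨a, p, hp, p.start_mem_support,
        p.snd_mem_support_of_mem_edges (hcc hp a p.start_mem_support b hab hb)⟩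
  · rintro ⟨hdis, hgain, hα⟩
    obtain ⟨hadj, S, h1, h2, h3, h4⟩ := hdis.indepNum_contraction_iff.1 hα
    exact defect_eq_zero_of_indepSet hW hdis hgain hadj h1 h2 h3 h4

end SimpleGraph

/-! ### Translation to gain graphs -/

namespace ComplexUnitGainGraph

variable {V : Type*} (Φ : ComplexUnitGainGraph V)

open Classical in
/-- The adjacency matrix, completed to a Hermitian matrix all of whose entries have modulus `1`. -/
noncomputable def fullMatrix : Matrix V V ℂ :=
  Matrix.of fun u v => if h : Φ.graph.Adj u v then (Φ.gain ⟨(u, v), h⟩ : ℂ) else 1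

lemma fullMatrix_of_adj {u v : V} (h : Φ.graph.Adj u v) :
    Φ.fullMatrix u v = (Φ.gain ⟨(u, v), h⟩ : ℂ) := dif_pos h

lemma fullMatrix_of_not_adj {u v : V} (h : ¬ Φ.graph.Adj u v) : Φ.fullMatrix u v = 1 := dif_neg h

lemma isUnitHermitian_fullMatrix : SimpleGraph.IsUnitHermitian Φ.fullMatrix := by
  constructor
  · ext u v
    rw [Matrix.conjTranspose_apply]
    by_cases h : Φ.graph.Adj v u
    · rw [Φ.fullMatrix_of_adj h, Φ.fullMatrix_of_adj h.symm]
      have := Φ.gain_symm ⟨(v, u), h⟩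
      change Φ.gain ⟨(u, v), h.symm⟩ = _ at this
      rw [this, Circle.coe_inv_eq_conj]
      rfl
    · rw [Φ.fullMatrix_of_not_adj h, Φ.fullMatrix_of_not_adj fun h' => h h'.symm, star_one]
  · intro u v
    by_cases h : Φ.graph.Adj u v
    · rw [Φ.fullMatrix_of_adj h, Circle.norm_coe]
    · rw [Φ.fullMatrix_of_not_adj h, norm_one]

lemma mask_fullMatrix : SimpleGraph.mask Φ.fullMatrix Φ.graph = Φ.adjMatrix := by
  ext u v
  rw [SimpleGraph.mask_apply]
  by_cases h : Φ.graph.Adj u v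
  · rw [if_pos h, Φ.fullMatrix_of_adj h]
    simp [adjMatrix, h]
  · rw [if_neg h]
    simp [adjMatrix, h]

lemma walkProd_fullMatrix {u v : V} (p : Φ.graph.Walk u v) :
    SimpleGraph.walkProd Φ.fullMatrix p = (Φ.walkGain p : ℂ) := by
  induction p with
  | nil => simp [SimpleGraph.walkProd, walkGain]
  | cons h p ih =>
    have h1 : SimpleGraph.walkProd Φ.fullMatrix (.cons h p) =
        SimpleGraph.walkProd Φ.fullMatrix p * Φ.fullMatrix _ _ := Finset.prod_range_succ' _ _
    rw [h1, ih]
    simp [walkGain, Φ.fullMatrix_of_adj h, mul_comm]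

end ComplexUnitGainGraph

theorem theorem2 {V : Type*} [Fintype V] (Φ : ComplexUnitGainGraph V) :
    (Φ.rank : ℤ) =
        2 * (Fintype.card V : ℤ) - 2 * Φ.graph.cyclomaticNumber - 2 * (Φ.graph.indepNum : ℤ) ↔
      (Φ.graph.cycleSubgraphs.Pairwise fun C D => Disjoint C.verts D.verts) ∧
      (∀ (v : V) (p : Φ.graph.Walk v v), p.IsCycle →
        (Even p.length ∧ (Φ.walkGain p : ℂ) = (-1) ^ (p.length / 2)) ∨
        (Odd p.length ∧ ((-1) ^ ((p.length - 1) / 2) * (Φ.walkGain p : ℂ)).re = 0)) ∧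
      (Φ.graph.cycleContraction.indepNum : ℤ) =
        (Φ.graph.reducedCycleContraction.indepNum : ℤ) + Φ.graph.cyclomaticNumber := by
  classical
  have h := SimpleGraph.defect_eq_zero_iff Φ.isUnitHermitian_fullMatrix Φ.graph
  simp only [SimpleGraph.defect, Φ.mask_fullMatrix, Φ.walkProd_fullMatrix, SingularGain] at h
  rw [SimpleGraph.pairwise_disjoint_iff_disjointCycles, ← h]
  unfold ComplexUnitGainGraph.rank
  constructor <;> intro h <;> linarith
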